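/- Let $M$ be a monoid (written multiplicatively). A \emph{Schreier extension of $M$ with commutative kernel} is a sequence of monoids and homomorphisms $\mathbb E\colon K\xrightarrow{k}X\xrightarrow{f}M$ ($K$, $X$ written additively), with $K$ commutative, $f$ surjective and $k$ a kernel of $f$, such that every $m\in M$ has a \emph{representative}: an element $u\in f^{-1}(m)$ such that each $x\in f^{-1}(m)$ can be written as $x=k(a)+u$ for a unique $a\in K$. Morphisms $(\alpha_1,\alpha)\colon\mathbb E\to\mathbb E'$ are pairs of homomorphisms $\alpha_1\colon K\to K'$, $\alpha\colon X\to X'$ with $\alpha k=k'\alpha_1$ and $f'\alpha=f$, such that $\alpha$ sends representatives to representatives. Such an extension determines a map $M\times K\to K$, $(m,a)\mapsto m\ast a$, by $u+k(a)=k(m\ast a)+u$ for any representative $u$ of $m$. Let $smod\text{-}SExt_M$ be the full subcategory of those extensions for which $\ast$ is an action of $M$ on $K$ by monoid endomorphisms, and $cc\text{-}SExt_M$ the full subcategory of those with $K$ cancellative (for these $\ast$ is automatically an action). Let $\mathcal Smod_M$ be the category of $M$-semimodules, i.e. pairs $(K,\eta)$ of a commutative monoid $K$ and a monoid homomorphism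 $\eta\colon M\to\mathrm{End}(K)$, with action-preserving homomorphisms as morphisms, and $c\text{-}\mathcal Smod_M$ its full subcategory of semimodules with $K$ cancellative. Let $D\colon smod\text{-}SExt_M\to\mathcal Smod_M$ be the direction functor, $D(\mathbb E)=(K,\ast)$, $D(\alpha_1,\alpha)=\alpha_1$, and let $d\colon cc\text{-}SExt_M\to c\text{-}\mathcal Smod_M$ be its restriction. These categories have finite products: the product $\mathbb E\times\mathbb E'$ of extensions is $K\times K'\to X\times_MX'\to M$, the terminal extension is $\mathbb 1\colon 0\to M= M$, and each semimodule $(K,\eta)$ is an internal commutative monoid in semimodules via $+\colon K\times K\to K$ and $0\to K$. A morphism $f\colon Y\to X$ is \emph{cocartesian} for a functor $F$ over $\alpha$ if $Ff=\alpha$ and for all $g\colon Y\to Z$ and $\beta$ with $Fg=\beta\alpha$ there is a unique $h$ with $Fh=\beta$ and $g=hf$. \textbf{Statement.} For every $M$-semimodule $(K,\eta)$, the fibre $D^{-1}(K,\eta)$ (objects $\mathbb E$ with $D(\mathbb E)=(K,\eta)$, morphisms sent by $D$ to the identity) carries a canonical symmetric monoidal structure $(\otimes,I)$, the (generalised) Baer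 sum. Precisely: (1) there is a symmetric monoidal structure on $D^{-1}(K,\eta)$ together with morphisms of extensions $\mathbb 1\to I$, cocartesian over $0\to K$, and $\mathbb E\times\mathbb E'\to\mathbb E\otimes\mathbb E'$, cocartesian over $+\colon K\times K\to K$, which make the inclusion of the fibre into $smod\text{-}SExt_M$ (with its finite products) a lax symmetric monoidal functor; (2) for any two structures as in (1), there is exactly one strong symmetric monoidal structure on the identity functor of $D^{-1}(K,\eta)$, from the first structure to the second, that is compatible with the given cocartesian morphisms. The same holds for the fibres $d^{-1}(K,\eta)$ of $d\colon cc\text{-}SExt_M\to c\text{-}\mathcal Smod_M$, for every $(K,\eta)$ in $c\text{-}\mathcal Smod_M$ (with $cc\text{-}SExt_M$ in place of $smod\text{-}SExt_M$). -/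

import Mathlib

open CategoryTheory MonoidalCategory CartesianMonoidalCategory Limits

universe v₁ v₂ u₁ u₂ u

noncomputable section

namespace Schreier

/-! ### Monoid extensions with commutative kernel, representatives, Schreier extensions -/

/-- A monoid extension `K ↣ X ↠ M` with commutative kernel `K`: `k` is a kernel of `f` and `f` is a
surjective monoid homomorphism.  `K` and `X` are written additively, `M` multiplicatively. -/
structure Ext (M : Type u) [Monoid M] where
  K : Type u
  X : Type u
  [instK : AddCommMonoid K]
  [instX : AddMonoid X]
  k : K →+ X
  f : X →+ Additive M
  k_injective : Function.Injective k
  ker_f : ∀ x : X, f x = 0 ↔ ∃ a : K, k a = x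
  f_surjective : Function.Surjective f

attribute [instance] Ext.instK Ext.instX

section Basic

variable {M : Type u} [Monoid M]

namespace Ext

theorem f_k (E : Ext M) (a : E.K) : E.f (E.k a) = 0 := (E.ker_f _).2 ⟨a, rfl⟩

/-- `u ∈ B_m`: `u` is a representative of `m`. -/
def IsRep (E : Ext M) (m : M) (u : E.X) : Prop :=
  E.f u = Additive.ofMul m ∧
    ∀ x : E.X, E.f x = Additive.ofMul m → ∃! a : E.K, x = E.k a + u

/-- A Schreier extension: every `m` has a representative. -/
def IsSchreier (E : Ext M) : Prop := ∀ m : M, ∃ u : E.X, E.IsRep m u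

theorem IsRep.unique {E : Ext M} {m : M} {u : E.X} (hu : E.IsRep m u) {a b : E.K}
    (h : E.k a + u = E.k b + u) : a = b := by
  have hf : E.f (E.k a + u) = Additive.ofMul m := by
    rw [map_add, f_k, zero_add]; exact hu.1
  exact (hu.2 _ hf).unique rfl h

theorem isRep_zero (E : Ext M) : E.IsRep 1 0 := by
  refine ⟨by simp, fun x hx => ?_⟩
  obtain ⟨a, rfl⟩ := (E.ker_f x).1 hx
  exact ⟨a, by simp, fun b hb => E.k_injective (by simpa using hb.symm)⟩

/-- Independence of `m ∗ a` of the choice of the representative of `m`. -/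
theorem existsUnique_act {E : Ext M} (hE : E.IsSchreier) (m : M) (a : E.K) :
    ∃! b : E.K, ∀ u : E.X, E.IsRep m u → u + E.k a = E.k b + u := by
  obtain ⟨u₀, h₀⟩ := hE m
  have hf : E.f (u₀ + E.k a) = Additive.ofMul m := by
    rw [map_add, f_k, add_zero]; exact h₀.1
  obtain ⟨b, hb, -⟩ := h₀.2 _ hf
  refine ⟨b, fun u hu => ?_, fun c hc => ?_⟩
  · obtain ⟨c, hc, -⟩ := h₀.2 u hu.1
    rw [hc, add_assoc, hb, ← add_assoc, ← add_assoc, ← map_add, ← map_add, add_comm]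
  · exact h₀.unique ((hc u₀ h₀).symm.trans hb)

/-- The map `(m, a) ↦ m ∗ a` induced by a Schreier extension with commutative kernel: `m ∗ a` is the
element of `K` with `u + k a = k (m ∗ a) + u` for the representatives `u` of `m`. -/
def act {E : Ext M} (hE : E.IsSchreier) (m : M) (a : E.K) : E.K :=
  (existsUnique_act hE m a).choose

theorem act_spec {E : Ext M} (hE : E.IsSchreier) {m : M} {u : E.X} (hu : E.IsRep m u) (a : E.K) :
    u + E.k a = E.k (act hE m a) + u :=
  (existsUnique_act hE m a).choose_spec.1 u hu

theorem act_eq {E : Ext M} (hE : E.IsSchreier) {m : M} {u : E.X} (hu : E.IsRep m u) {a b : E.K}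
    (h : u + E.k a = E.k b + u) : act hE m a = b :=
  hu.unique ((act_spec hE hu a).symm.trans h)

/-- Morphisms of Schreier extensions that are the identity on `M`: pairs of monoid homomorphisms
making both squares commute and preserving representatives. -/
@[ext]
structure Hom (E E' : Ext M) where
  left : E.K →+ E'.K
  mid : E.X →+ E'.X
  mid_k : ∀ a, mid (E.k a) = E'.k (left a)
  f_mid : ∀ x, E'.f (mid x) = E.f x
  isRep_mid : ∀ m u, E.IsRep m u → E'.IsRep m (mid u)

theorem Hom.left_act {E E' : Ext M} (α : Hom E E') (hE : E.IsSchreier) (hE' : E'.IsSchreier)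
    (m : M) (a : E.K) : α.left (act hE m a) = act hE' m (α.left a) := by
  obtain ⟨u, hu⟩ := hE m
  refine (act_eq hE' (α.isRep_mid m u hu) ?_).symm
  rw [← α.mid_k, ← α.mid_k, ← map_add, ← map_add, act_spec hE hu a]

instance : Category (Ext M) where
  Hom := Hom
  id E := ⟨AddMonoidHom.id _, AddMonoidHom.id _, fun _ => rfl, fun _ => rfl, fun _ _ h => h⟩
  comp α β := ⟨β.left.comp α.left, β.mid.comp α.mid,
    fun a => by simp [α.mid_k, β.mid_k], fun x => by simp [α.f_mid, β.f_mid],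
    fun m u h => β.isRep_mid _ _ (α.isRep_mid _ _ h)⟩

@[ext]
theorem hom_ext {E E' : Ext M} {α β : E ⟶ E'} (h₁ : ∀ a, α.left a = β.left a)
    (h₂ : ∀ x, α.mid x = β.mid x) : α = β :=
  Hom.ext (AddMonoidHom.ext h₁) (AddMonoidHom.ext h₂)

@[simp] theorem id_left (E : Ext M) (a : E.K) : Hom.left (𝟙 E) a = a := rfl
@[simp] theorem id_mid (E : Ext M) (x : E.X) : Hom.mid (𝟙 E) x = x := rfl
@[simp] theorem comp_left {E E' E'' : Ext M} (α : E ⟶ E') (β : E' ⟶ E'') (a : E.K) :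
    Hom.left (α ≫ β) a = β.left (α.left a) := rfl
@[simp] theorem comp_mid {E E' E'' : Ext M} (α : E ⟶ E') (β : E' ⟶ E'') (x : E.X) :
    Hom.mid (α ≫ β) x = β.mid (α.mid x) := rfl

/-! ### Finite products of extensions -/

/-- The trivial extension `0 ↣ M = M`. -/
def triv (M : Type u) [Monoid M] : Ext M where
  K := PUnit
  X := Additive M
  k := 0
  f := AddMonoidHom.id _
  k_injective := fun _ _ _ => rfl
  ker_f := fun _ => ⟨fun h => ⟨PUnit.unit, h.symm⟩, fun ⟨_, h⟩ => h.symm⟩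
  f_surjective := Function.surjective_id

theorem isRep_triv (m : M) : (triv M).IsRep m (Additive.ofMul m : Additive M) := by
  refine ⟨rfl, fun x hx => ⟨PUnit.unit, ?_, fun _ _ => rfl⟩⟩
  exact (show x = Additive.ofMul m from hx).trans (zero_add _).symm

theorem isSchreier_triv : (triv M).IsSchreier := fun m => ⟨_, isRep_triv m⟩

/-- The extension `K × K' ↣ X ×_M X' ↠ M`. -/
def prod (E E' : Ext M) : Ext M where
  K := E.K × E'.K
  X := (E.f.comp (AddMonoidHom.fst E.X E'.X)).eqLocusM (E'.f.comp (AddMonoidHom.snd E.X E'.X))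
  k := (E.k.prodMap E'.k).codRestrict _ fun a => (E.f_k a.1).trans (E'.f_k a.2).symm
  f := (E.f.comp (AddMonoidHom.fst E.X E'.X)).comp (AddSubmonoid.subtype _)
  k_injective := fun a b h => by
    have h' := congrArg Subtype.val h
    exact Prod.ext (E.k_injective (congrArg Prod.fst h')) (E'.k_injective (congrArg Prod.snd h'))
  ker_f := by
    rintro ⟨⟨x, x'⟩, hx⟩
    constructor
    · intro h
      obtain ⟨a, ha⟩ := (E.ker_f x).1 h
      obtain ⟨a', ha'⟩ := (E'.ker_f x').1 (hx.symm.trans h)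
      exact ⟨(a, a'), Subtype.ext (Prod.ext ha ha')⟩
    · rintro ⟨⟨a, a'⟩, h⟩
      exact (E.ker_f x).2 ⟨a, congrArg (fun z => z.1.1) h⟩
  f_surjective := fun m => by
    obtain ⟨x, hx⟩ := E.f_surjective m
    obtain ⟨x', hx'⟩ := E'.f_surjective m
    exact ⟨⟨(x, x'), hx.trans hx'.symm⟩, hx⟩

theorem isRep_prod {E E' : Ext M} {m : M} (u : (prod E E').X) :
    (prod E E').IsRep m u ↔ E.IsRep m u.1.1 ∧ E'.IsRep m u.1.2 := by
  obtain ⟨⟨u, u'⟩, hu⟩ := u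
  replace hu : E.f u = E'.f u' := hu
  constructor
  · rintro ⟨h₁, h₂⟩
    replace h₁ : E.f u = Additive.ofMul m := h₁
    have h₁' : E'.f u' = Additive.ofMul m := hu.symm.trans h₁
    refine ⟨⟨h₁, fun x hx => ?_⟩, ⟨h₁', fun x hx => ?_⟩⟩
    · obtain ⟨⟨a, a'⟩, ha, hun⟩ := h₂ ⟨(x, u'), hx.trans h₁'.symm⟩ hx
      have ha₂ := congrArg (fun z => z.1.2) ha
      exact ⟨a, congrArg (fun z => z.1.1) ha, fun b hb =>
        congrArg Prod.fst (hun (b, a') (Subtype.ext (Prod.ext hb ha₂)))⟩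
    · obtain ⟨⟨a, a'⟩, ha, hun⟩ := h₂ ⟨(u, x), h₁.trans hx.symm⟩ h₁
      have ha₁ := congrArg (fun z => z.1.1) ha
      exact ⟨a', congrArg (fun z => z.1.2) ha, fun b hb =>
        congrArg Prod.snd (hun (a, b) (Subtype.ext (Prod.ext ha₁ hb)))⟩
  · rintro ⟨⟨h₁, h₂⟩, ⟨h₁', h₂'⟩⟩
    refine ⟨h₁, ?_⟩
    rintro ⟨⟨x, x'⟩, hxx⟩ hx
    obtain ⟨a, ha, hun⟩ := h₂ x hx
    obtain ⟨a', ha', hun'⟩ := h₂' x' (hxx.symm.trans hx)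
    refine ⟨(a, a'), Subtype.ext (Prod.ext ha ha'), ?_⟩
    rintro ⟨b, b'⟩ hb
    exact Prod.ext (hun b (congrArg (fun z => z.1.1) hb)) (hun' b' (congrArg (fun z => z.1.2) hb))

theorem IsSchreier.prod {E E' : Ext M} (hE : E.IsSchreier) (hE' : E'.IsSchreier) :
    (prod E E').IsSchreier := fun m => by
  obtain ⟨u, hu⟩ := hE m
  obtain ⟨u', hu'⟩ := hE' m
  exact ⟨⟨(u, u'), hu.1.trans hu'.1.symm⟩, (isRep_prod _).2 ⟨hu, hu'⟩⟩

theorem act_prod {E E' : Ext M} (hE : E.IsSchreier) (hE' : E'.IsSchreier)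
    (hP : (Ext.prod E E').IsSchreier) (m : M) (a : E.K) (a' : E'.K) :
    act hP m ((a, a') : E.K × E'.K) = (act hE m a, act hE' m a') := by
  obtain ⟨u, hu⟩ := hP m
  have h := (isRep_prod u).1 hu
  exact act_eq hP hu (Subtype.ext (Prod.ext (act_spec hE h.1 a) (act_spec hE' h.2 a')))

def prodFst (E E' : Ext M) : prod E E' ⟶ E where
  left := AddMonoidHom.fst _ _
  mid := (AddMonoidHom.fst _ _).comp (AddSubmonoid.subtype _)
  mid_k := fun _ => rfl
  f_mid := fun _ => rfl
  isRep_mid := fun _ u h => ((isRep_prod u).1 h).1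

def prodSnd (E E' : Ext M) : prod E E' ⟶ E' where
  left := AddMonoidHom.snd _ _
  mid := (AddMonoidHom.snd _ _).comp (AddSubmonoid.subtype _)
  mid_k := fun _ => rfl
  f_mid := fun x => x.2.symm
  isRep_mid := fun _ u h => ((isRep_prod u).1 h).2

def prodLift {T E E' : Ext M} (α : T ⟶ E) (β : T ⟶ E') : T ⟶ prod E E' where
  left := α.left.prod β.left
  mid := (α.mid.prod β.mid).codRestrict _ fun x => (α.f_mid x).trans (β.f_mid x).symm
  mid_k := fun a => Subtype.ext (Prod.ext (α.mid_k a) (β.mid_k a))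
  f_mid := fun x => α.f_mid x
  isRep_mid := fun m u h => (isRep_prod _).2 ⟨α.isRep_mid m u h, β.isRep_mid m u h⟩

def toTriv (E : Ext M) : E ⟶ triv M where
  left := 0
  mid := E.f
  mid_k := fun a => E.f_k a
  f_mid := fun _ => rfl
  isRep_mid := fun m _ h => h.1.symm ▸ isRep_triv m

instance : CartesianMonoidalCategory (Ext M) :=
  .ofChosenFiniteProducts
    ⟨asEmptyCone (triv M), IsTerminal.ofUniqueHom toTriv fun _ α => hom_ext (fun _ => rfl)
      fun x => α.f_mid x⟩
    fun E E' => ⟨BinaryFan.mk (prodFst E E') (prodSnd E E'),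
      BinaryFan.IsLimit.mk _ prodLift (fun _ _ => rfl) (fun _ _ => rfl)
        fun _ _ _ h₁ h₂ => hom_ext
          (fun a => Prod.ext (congrArg (fun δ => Hom.left δ a) h₁)
            (congrArg (fun δ => Hom.left δ a) h₂))
          (fun x => Subtype.ext (Prod.ext (congrArg (fun δ => Hom.mid δ x) h₁)
            (congrArg (fun δ => Hom.mid δ x) h₂)))⟩

end Ext

/-! ### `M`-semimodules -/

/-- An `M`-semimodule: a commutative monoid with an action of `M` by endomorphisms. -/
structure Smod (M : Type u) [Monoid M] where
  K : Type u
  [instK : AddCommMonoid K]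
  η : M →* AddMonoid.End K

attribute [instance] Smod.instK

namespace Smod

/-- Action preserving monoid homomorphisms. -/
@[ext]
structure Hom (S S' : Smod M) where
  hom : S.K →+ S'.K
  hom_η : ∀ m a, hom (S.η m a) = S'.η m (hom a)

instance : Category (Smod M) where
  Hom := Hom
  id S := ⟨AddMonoidHom.id _, fun _ _ => rfl⟩
  comp α β := ⟨β.hom.comp α.hom, fun m a => by simp [α.hom_η, β.hom_η]⟩

@[ext]
theorem hom_ext {S S' : Smod M} {α β : S ⟶ S'} (h : ∀ a, α.hom a = β.hom a) : α = β :=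
  Hom.ext (AddMonoidHom.ext h)

@[simp] theorem id_hom (S : Smod M) (a : S.K) : Hom.hom (𝟙 S) a = a := rfl
@[simp] theorem comp_hom {S S' S'' : Smod M} (α : S ⟶ S') (β : S' ⟶ S'') (a : S.K) :
    Hom.hom (α ≫ β) a = β.hom (α.hom a) := rfl

/-- The zero semimodule. -/
def zero (M : Type u) [Monoid M] : Smod M where
  K := PUnit
  η := 1

/-- The product semimodule, with the componentwise action. -/
def prod (S S' : Smod M) : Smod M where
  K := S.K × S'.K
  η :=
    { toFun := fun m => AddMonoidHom.prodMap (S.η m) (S'.η m)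
      map_one' := AddMonoidHom.ext fun a => Prod.ext
        (by rw [map_one, map_one]; rfl) (by rw [map_one, map_one]; rfl)
      map_mul' := fun _ _ => AddMonoidHom.ext fun a => Prod.ext
        (by rw [map_mul, map_mul]; rfl) (by rw [map_mul, map_mul]; rfl) }

def prodFst (S S' : Smod M) : prod S S' ⟶ S := ⟨AddMonoidHom.fst _ _, fun _ _ => rfl⟩

def prodSnd (S S' : Smod M) : prod S S' ⟶ S' := ⟨AddMonoidHom.snd _ _, fun _ _ => rfl⟩

def prodLift {T S S' : Smod M} (α : T ⟶ S) (β : T ⟶ S') : T ⟶ prod S S' :=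
  ⟨α.hom.prod β.hom, fun m a => Prod.ext (α.hom_η m a) (β.hom_η m a)⟩

def toZero (S : Smod M) : S ⟶ zero M := ⟨0, fun _ _ => rfl⟩

instance : CartesianMonoidalCategory (Smod M) :=
  .ofChosenFiniteProducts
    ⟨asEmptyCone (zero M), IsTerminal.ofUniqueHom toZero fun _ _ => hom_ext fun _ => rfl⟩
    fun S S' => ⟨BinaryFan.mk (prodFst S S') (prodSnd S S'),
      BinaryFan.IsLimit.mk _ prodLift (fun _ _ => rfl) (fun _ _ => rfl)
        fun _ _ _ h₁ h₂ => hom_ext fun a => Prod.ext (congrArg (fun δ => Hom.hom δ a) h₁)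
          (congrArg (fun δ => Hom.hom δ a) h₂)⟩

/-- The addition `K × K → K`. -/
def add (S : Smod M) : S ⊗ S ⟶ S where
  hom := AddMonoidHom.coprod (AddMonoidHom.id S.K) (AddMonoidHom.id S.K)
  hom_η := fun m a => ((S.η m).map_add a.1 a.2).symm

/-- The zero map `0 → K`. -/
def zeroMap (S : Smod M) : 𝟙_ (Smod M) ⟶ S where
  hom := 0
  hom_η := fun m _ => ((S.η m).map_zero).symm

/-- Every `M`-semimodule is an internal monoid in `M`-semimodules by its own addition. -/
instance (S : Smod M) : MonObj S where
  one := S.zeroMap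
  mul := S.add
  one_mul := hom_ext fun a => zero_add a.2
  mul_one := hom_ext fun a => add_zero a.1
  mul_assoc := hom_ext fun a => add_assoc a.1.1 a.1.2 a.2

end Smod

/-! ### The categories `smod-SExt_M`, `cc-SExt_M`, `c-Smod_M` -/

/-- The Schreier extensions for which `(m, a) ↦ m ∗ a` is an action of `M` on `K`. -/
def IsSmodSExt (M : Type u) [Monoid M] : ObjectProperty (Ext M) := fun E =>
  ∃ hE : E.IsSchreier,
    (∀ a : E.K, E.act hE 1 a = a) ∧
    (∀ m : M, E.act hE m 0 = 0) ∧
    (∀ (m : M) (a a' : E.K), E.act hE m (a + a') = E.act hE m a + E.act hE m a') ∧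
    (∀ (m' m : M) (a : E.K), E.act hE (m' * m) a = E.act hE m' (E.act hE m a))

/-- The Schreier extensions with (commutative and) cancellative kernel. -/
def IsCCSExt (M : Type u) [Monoid M] : ObjectProperty (Ext M) := fun E =>
  E.IsSchreier ∧ IsCancelAdd E.K

/-- The semimodules with cancellative underlying monoid. -/
def IsCSmod (M : Type u) [Monoid M] : ObjectProperty (Smod M) := fun S => IsCancelAdd S.K

abbrev SmodSExt (M : Type u) [Monoid M] := (IsSmodSExt M).FullSubcategory
abbrev CCSExt (M : Type u) [Monoid M] := (IsCCSExt M).FullSubcategory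
abbrev CSmod (M : Type u) [Monoid M] := (IsCSmod M).FullSubcategory

theorem IsCCSExt.isSmodSExt : IsCCSExt M ≤ IsSmodSExt M := by
  rintro E ⟨hE, hc⟩
  refine ⟨hE, fun a => ?_, fun m => ?_, fun m a a' => ?_, fun m' m a => ?_⟩
  · exact Ext.act_eq hE E.isRep_zero (by simp)
  · obtain ⟨u, hu⟩ := hE m
    exact Ext.act_eq hE hu (by simp)
  · obtain ⟨u, hu⟩ := hE m
    refine Ext.act_eq hE hu ?_
    rw [map_add, ← add_assoc, Ext.act_spec hE hu, add_assoc, Ext.act_spec hE hu, ← add_assoc,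
      map_add]
  · obtain ⟨u, hu⟩ := hE m
    obtain ⟨u', hu'⟩ := hE m'
    obtain ⟨w, hw⟩ := hE (m' * m)
    obtain ⟨l, hl, -⟩ := hw.2 (u' + u) (by rw [map_add, hu.1, hu'.1]; rfl)
    have h : E.k (l + Ext.act hE (m' * m) a) + w =
        E.k (l + Ext.act hE m' (Ext.act hE m a)) + w := by
      calc E.k (l + Ext.act hE (m' * m) a) + w
          = E.k l + w + E.k a := by
            rw [map_add, add_assoc, ← Ext.act_spec hE hw, add_assoc]
        _ = u' + (u + E.k a) := by rw [← hl, add_assoc]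
        _ = E.k (Ext.act hE m' (Ext.act hE m a)) + (E.k l + w) := by
            rw [Ext.act_spec hE hu, ← add_assoc, Ext.act_spec hE hu', add_assoc, hl]
        _ = _ := by rw [← add_assoc, ← map_add, add_comm l]
    exact add_left_cancel (hw.unique h)

/-- A full subcategory containing the terminal object and closed under binary products inherits the
chosen finite products. -/
abbrev cartesianFull {C : Type u₁} [Category.{v₁} C] [CartesianMonoidalCategory C]
    (P : ObjectProperty C) (h₁ : P (𝟙_ C)) (h₂ : ∀ X Y, P X → P Y → P (X ⊗ Y)) :
    CartesianMonoidalCategory P.FullSubcategory :=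
  .ofChosenFiniteProducts
    ⟨asEmptyCone ⟨𝟙_ C, h₁⟩, IsTerminal.ofUniqueHom
      (fun X => ObjectProperty.homMk (toUnit X.1))
      fun _ _ => ObjectProperty.hom_ext _ (toUnit_unique _ _)⟩
    fun X Y => ⟨BinaryFan.mk (P := (⟨X.1 ⊗ Y.1, h₂ _ _ X.2 Y.2⟩ : P.FullSubcategory))
        (ObjectProperty.homMk (fst X.1 Y.1)) (ObjectProperty.homMk (snd X.1 Y.1)),
      BinaryFan.IsLimit.mk _ (fun α β => ObjectProperty.homMk (lift α.hom β.hom))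
        (fun _ _ => ObjectProperty.hom_ext _ (lift_fst _ _))
        (fun _ _ => ObjectProperty.hom_ext _ (lift_snd _ _))
        fun _ _ _ h h' => ObjectProperty.hom_ext _ (CartesianMonoidalCategory.hom_ext _ _
          ((congrArg (fun δ => δ.hom) h).trans (lift_fst _ _).symm)
          ((congrArg (fun δ => δ.hom) h').trans (lift_snd _ _).symm))⟩

theorem isSmodSExt_triv : IsSmodSExt M (Ext.triv M) :=
  ⟨Ext.isSchreier_triv, fun _ => rfl, fun _ => rfl, fun _ _ _ => rfl, fun _ _ _ => rfl⟩

theorem isSmodSExt_prod (E E' : Ext M) (h : IsSmodSExt M E) (h' : IsSmodSExt M E') :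
    IsSmodSExt M (Ext.prod E E') := by
  obtain ⟨hE, h₁, h₂, h₃, h₄⟩ := h
  obtain ⟨hE', h₁', h₂', h₃', h₄'⟩ := h'
  refine ⟨hE.prod hE', ?_, fun m => ?_, ?_, ?_⟩
  · rintro ⟨a, a'⟩
    rw [Ext.act_prod hE hE', h₁, h₁']
  · exact (Ext.act_prod hE hE' _ m 0 0).trans (Prod.ext (h₂ m) (h₂' m))
  · rintro m ⟨a, a'⟩ ⟨b, b'⟩
    refine (Ext.act_prod hE hE' _ m (a + b) (a' + b')).trans ?_
    rw [h₃, h₃', Ext.act_prod hE hE', Ext.act_prod hE hE']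
    rfl
  · rintro m n ⟨a, a'⟩
    rw [Ext.act_prod hE hE', Ext.act_prod hE hE', Ext.act_prod hE hE', h₄, h₄']

instance : CartesianMonoidalCategory (SmodSExt M) :=
  cartesianFull _ isSmodSExt_triv isSmodSExt_prod

instance : BraidedCategory (SmodSExt M) := .ofCartesianMonoidalCategory

theorem isCancelAdd_prod {A B : Type u} [AddCommMonoid A] [AddCommMonoid B] (hA : IsCancelAdd A)
    (hB : IsCancelAdd B) : IsCancelAdd (A × B) := inferInstance

theorem isCancelAdd_punit : IsCancelAdd PUnit.{u + 1} where
  add_left_cancel := fun _ _ _ _ => rfl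
  add_right_cancel := fun _ _ _ _ => rfl

instance : CartesianMonoidalCategory (CCSExt M) :=
  cartesianFull _ ⟨Ext.isSchreier_triv, isCancelAdd_punit⟩
    fun _ _ h h' => ⟨h.1.prod h'.1, isCancelAdd_prod h.2 h'.2⟩

instance : BraidedCategory (CCSExt M) := .ofCartesianMonoidalCategory

instance : CartesianMonoidalCategory (CSmod M) :=
  cartesianFull _ isCancelAdd_punit fun _ _ h h' => isCancelAdd_prod h h'

instance (S : CSmod M) : MonObj S where
  one := ObjectProperty.homMk S.obj.zeroMap
  mul := ObjectProperty.homMk S.obj.add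
  one_mul := ObjectProperty.hom_ext _ (Smod.hom_ext fun a => zero_add a.2)
  mul_one := ObjectProperty.hom_ext _ (Smod.hom_ext fun a => add_zero a.1)
  mul_assoc := ObjectProperty.hom_ext _ (Smod.hom_ext fun a => add_assoc a.1.1 a.1.2 a.2)

/-! ### The direction functors -/

/-- The semimodule `(K, η)` given by the action induced by an extension. -/
def direction (E : SmodSExt M) : Smod M where
  K := E.obj.K
  η :=
    { toFun := fun m =>
        { toFun := Ext.act E.property.choose m
          map_zero' := E.property.choose_spec.2.1 m
          map_add' := E.property.choose_spec.2.2.1 m }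
      map_one' := AddMonoidHom.ext E.property.choose_spec.1
      map_mul' := fun m' m => AddMonoidHom.ext (E.property.choose_spec.2.2.2 m' m) }

variable (M)

/-- The direction functor `D : smod-SExt_M ⥤ Smod_M`. -/
def D : SmodSExt M ⥤ Smod M where
  obj E := direction E
  map {E E'} α :=
    { hom := α.hom.left
      hom_η := α.hom.left_act E.property.choose E'.property.choose }

/-- The direction functor `d : cc-SExt_M ⥤ c-Smod_M`, the restriction of `D`. -/
def d : CCSExt M ⥤ CSmod M :=
  (IsCSmod M).lift (ObjectProperty.ιOfLE IsCCSExt.isSmodSExt ⋙ D M) fun E => E.property.2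

end Basic

/-! ### Symmetric monoidal structures on a fibre lifted from an internal monoid -/

section Fibre

variable {U : Type u₁} [Category.{v₁} U] [CartesianMonoidalCategory U] [BraidedCategory U]
  {V : Type u₂} [Category.{v₂} V] [CartesianMonoidalCategory V]

open Functor.Fiber (fiberInclusion)
open Functor.LaxMonoidal

/-- For `F A = N` and `F B = N`, the morphism `F (A × B) ⟶ F A × F B = N × N ⟶ N`, where the last
arrow is the multiplication of the internal monoid `N`. -/
def mulBase (F : U ⥤ V) (N : V) [MonObj N] (A B : F.Fiber N) : F.obj (A.1 ⊗ B.1) ⟶ N :=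
  lift (F.map (fst A.1 B.1) ≫ eqToHom A.2) (F.map (snd A.1 B.1) ≫ eqToHom B.2) ≫ MonObj.mul

/-- The morphism `F 1 ⟶ 1 ⟶ N`, where the last arrow is the unit of the internal monoid `N`. -/
def oneBase (F : U ⥤ V) (N : V) [MonObj N] : F.obj (𝟙_ U) ⟶ N :=
  toUnit _ ≫ MonObj.one

/-- A symmetric monoidal structure on the fibre of `F` at `N` that is induced by the internal monoid
structure of `N`: there are cocartesian morphisms `1 ⟶ I` over the unit of `N` and
`A × B ⟶ A ⊗ B` over the multiplication of `N`, natural in `A` and `B`, that carry the associativity,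
unit and symmetry isomorphisms of the finite products of `U` to those of the fibre (that is, they
make the inclusion of the fibre in `U` a lax symmetric monoidal functor). -/
structure FibreTensor (F : U ⥤ V) (N : V) [MonObj N] where
  [monoidal : MonoidalCategory (F.Fiber N)]
  [symmetric : SymmetricCategory (F.Fiber N)]
  [lax : (fiberInclusion : F.Fiber N ⥤ U).LaxBraided]
  unit_cocartesian : F.IsStronglyCocartesian (oneBase F N)
    (ε (fiberInclusion : F.Fiber N ⥤ U))
  tensor_cocartesian : ∀ A B : F.Fiber N, F.IsStronglyCocartesian (mulBase F N A B)
    (μ (fiberInclusion : F.Fiber N ⥤ U) A B)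

namespace FibreTensor

variable {F : U ⥤ V} {N : V} [MonObj N]

/-- The fibre, as a category equipped with the symmetric monoidal structure `T`. -/
def Carrier (_T : FibreTensor F N) := F.Fiber N

variable (T T' : FibreTensor F N)

instance : Category T.Carrier := inferInstanceAs (Category (F.Fiber N))
instance : MonoidalCategory T.Carrier := T.monoidal
instance : SymmetricCategory T.Carrier := T.symmetric

/-- The inclusion of the fibre. -/
def incl : T.Carrier ⥤ U := (fiberInclusion : F.Fiber N ⥤ U)

instance : T.incl.LaxBraided := T.lax

/-- The identity functor of the fibre, from the structure `T` to the structure `T'`. -/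
def idFunctor : T.Carrier ⥤ T'.Carrier := 𝟭 (F.Fiber N)

/-- A strong symmetric monoidal structure on the identity functor of the fibre (isomorphisms
`I' ≅ I` and `A ⊗' B ≅ A ⊗ B`) that commutes with the cocartesian morphisms of `T` and `T'`. -/
structure Comparison where
  [braided : (idFunctor T T').Braided]
  unit_comp : ε T'.incl ≫ T'.incl.map (ε (idFunctor T T')) = ε T.incl
  tensor_comp : ∀ A B : T.Carrier,
    μ T'.incl ((idFunctor T T').obj A) ((idFunctor T T').obj B) ≫
      T'.incl.map (μ (idFunctor T T') A B) = μ T.incl A B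

end FibreTensor

end Fibre

end Schreier

end

noncomputable section

namespace Schreier

open Functor.Fiber (fiberInclusion)
open Functor.LaxMonoidal

/-! The argument rests on two properties of the direction functors, collected in
`CofibredInGroupoids`: every morphism upstairs is cocartesian, and every morphism out of `F.obj X`
has a lift out of `X`.

For such a functor, two morphisms `w : X ⟶ A` and `g : X ⟶ B` into fibre objects, lying over the
same morphism of the base, are linked by a unique fibre morphism `A ⟶ B`, which is invertible by
symmetry (`existsUnique_desc`, `descIso`, `hom_ext`). Lifting the unit and the multiplication of `N`
gives `I` and `⊗`. The two sides of each structure isomorphism receive morphisms from one product in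
`U`, lying over equal maps by the axioms of the commutative monoid `N` (the `map_*_conv` lemmas). A
coherence law, precomposed with such a morphism, becomes the coherence law of finite products in
`U`. The same principle compares two structures: their maps `ε` and `μ` lie over the same morphisms,
which forces the comparison isomorphisms and their axioms.

For extensions, a morphism `f : E ⟶ E'` preserves representatives, so every element of `E'` is `k a
+ f u` with `u` a representative in `E`. A morphism out of `E'` extending `ψ` over `g` must send it
to `k (g a) + ψ u`, and this is well defined because coefficients with respect to a representative
are unique (`Ext.existsUnique_desc`). For lifts, a normalised choice of representatives yields a
factor set; its image under `g` defines a crossed-product extension of the target semimodule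
(`Ext.exists_pushforward`). -/

/-- A functor all of whose morphisms are strongly cocartesian and which has cocartesian lifts, that
is, a functor cofibred in groupoids. -/
class CofibredInGroupoids {U : Type u₁} [Category.{v₁} U] {V : Type u₂} [Category.{v₂} V]
    (F : U ⥤ V) : Prop where
  cocartesian : ∀ {X Y : U} (f : X ⟶ Y), F.IsStronglyCocartesian (F.map f) f
  exists_lift : ∀ {X : U} {N : V} (φ : F.obj X ⟶ N),
    ∃ (Y : U) (h : F.obj Y = N) (f : X ⟶ Y), F.map f ≫ eqToHom h = φ

namespace CofibredInGroupoids

/-! ### Morphisms into the fibre of a functor cofibred in groupoids -/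

section Maps

variable {U : Type u₁} [Category.{v₁} U] {V : Type u₂} [Category.{v₂} V] {F : U ⥤ V} {N : V}

/-- The morphism of the base over which a morphism into an object of the fibre lies. -/
def baseMap {X : U} {A : F.Fiber N} (w : X ⟶ fiberInclusion.obj A) : F.obj X ⟶ N :=
  F.map w ≫ eqToHom A.2

theorem baseMap_comp {X Y : U} {A : F.Fiber N} (f : X ⟶ Y) (w : Y ⟶ fiberInclusion.obj A) :
    baseMap (f ≫ w) = F.map f ≫ baseMap w := by
  simp [baseMap]

@[simp]
theorem baseMap_comp_map {X : U} {A B : F.Fiber N} (w : X ⟶ fiberInclusion.obj A) (f : A ⟶ B) :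
    baseMap (w ≫ fiberInclusion.map f) = baseMap w := by
  have h := IsHomLift.fac' F (𝟙 N) (fiberInclusion.map f)
  simp only [baseMap, Functor.map_comp, Category.assoc, h, Category.id_comp]
  exact congrArg (F.map w ≫ ·) ((congrArg (_ ≫ ·) (eqToHom_trans _ _)).trans (eqToHom_trans _ _))

variable [CofibredInGroupoids F]

theorem isStronglyCocartesian_baseMap {X : U} {A : F.Fiber N} (w : X ⟶ fiberInclusion.obj A) :
    F.IsStronglyCocartesian (baseMap w) w := by
  -- Taking `N` to be `F.obj A` turns the `eqToHom` in `baseMap` into an identity.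
  obtain ⟨A, rfl⟩ := A
  have := cocartesian (F := F) w
  change F.IsStronglyCocartesian (F.map w ≫ 𝟙 _) w
  rw [Category.comp_id]
  exact this

/-- This is the universal property of the cocartesian morphism `w`, applied to the identity of `N`
in the base; it is the source of every morphism constructed in the fibre. -/
theorem existsUnique_desc {X : U} {A B : F.Fiber N} (w : X ⟶ fiberInclusion.obj A)
    (g : X ⟶ fiberInclusion.obj B) (h : baseMap g = baseMap w) :
    ∃! f : A ⟶ B, w ≫ fiberInclusion.map f = g := by
  have hw := isStronglyCocartesian_baseMap w
  have hg := isStronglyCocartesian_baseMap g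
  obtain ⟨f, ⟨hf, hfg⟩, hun⟩ := hw.universal_property F (baseMap w) w (𝟙 N) (baseMap g)
    (by rw [h, Category.comp_id]) g
  exact ⟨⟨f, hf⟩, hfg, fun f' hf' => Subtype.ext (hun f'.1 ⟨f'.2, hf'⟩)⟩

/-- The morphism of the fibre induced by two morphisms with the same source lying over the same
morphism of the base. -/
def desc {X : U} {A B : F.Fiber N} (w : X ⟶ fiberInclusion.obj A) (g : X ⟶ fiberInclusion.obj B)
    (h : baseMap g = baseMap w) : A ⟶ B :=
  (existsUnique_desc w g h).choose

@[simp]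
theorem fac {X : U} {A B : F.Fiber N} (w : X ⟶ fiberInclusion.obj A)
    (g : X ⟶ fiberInclusion.obj B) (h : baseMap g = baseMap w) :
    w ≫ fiberInclusion.map (desc w g h) = g :=
  (existsUnique_desc w g h).choose_spec.1

@[simp]
theorem fac_assoc {X : U} {A B : F.Fiber N} (w : X ⟶ fiberInclusion.obj A)
    (g : X ⟶ fiberInclusion.obj B) (h : baseMap g = baseMap w)
    {W : U} (z : _ ⟶ W) :
    w ≫ fiberInclusion.map (desc w g h) ≫ z = g ≫ z := by
  simpa only [Category.assoc] using fac _ _ _ =≫ z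

/-- Any morphism from `U` into a fibre object is epic against fibre morphisms, since both composites
lie over the same base map. Every equation in the fibre is checked in `U` through this. -/
theorem hom_ext {X : U} {A B : F.Fiber N} (w : X ⟶ fiberInclusion.obj A) {f g : A ⟶ B}
    (h : w ≫ fiberInclusion.map f = w ≫ fiberInclusion.map g) : f = g :=
  (existsUnique_desc w (w ≫ fiberInclusion.map g) (baseMap_comp_map _ _)).unique h rfl

/-- The isomorphism of the fibre induced by two morphisms with the same source lying over the same
morphism of the base. -/
def descIso {X : U} {A B : F.Fiber N} (w : X ⟶ fiberInclusion.obj A)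
    (g : X ⟶ fiberInclusion.obj B) (h : baseMap g = baseMap w) : A ≅ B where
  hom := desc w g h
  inv := desc g w h.symm
  hom_inv_id := hom_ext w (by simp)
  inv_hom_id := hom_ext g (by simp)

@[simp]
theorem comp_descIso_hom {X : U} {A B : F.Fiber N} (w : X ⟶ fiberInclusion.obj A)
    (g : X ⟶ fiberInclusion.obj B) (h : baseMap g = baseMap w) :
    w ≫ fiberInclusion.map (descIso w g h).hom = g :=
  fac w g h

theorem exists_baseMap_eq {X : U} (φ : F.obj X ⟶ N) :
    ∃ (A : F.Fiber N) (w : X ⟶ fiberInclusion.obj A), baseMap w = φ :=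
  let ⟨Y, h, f, hf⟩ := exists_lift φ
  ⟨⟨Y, h⟩, f, hf⟩

end Maps

/-! ### Monoid axioms of `N` as identities between base maps -/

section Convolution

variable {U : Type u₁} [Category.{v₁} U] [CartesianMonoidalCategory U]
  {V : Type u₂} [Category.{v₂} V] [CartesianMonoidalCategory V] {F : U ⥤ V} {N : V} [MonObj N]

/-- The product of morphisms to an internal monoid, along the two projections. -/
def conv {X Y : U} (φ : F.obj X ⟶ N) (ψ : F.obj Y ⟶ N) : F.obj (X ⊗ Y) ⟶ N :=
  lift (F.map (fst X Y) ≫ φ) (F.map (snd X Y) ≫ ψ) ≫ MonObj.mul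

theorem map_tensor_conv {X X' Y Y' : U} (f : X ⟶ X') (g : Y ⟶ Y') (φ : F.obj X' ⟶ N)
    (ψ : F.obj Y' ⟶ N) :
    F.map (f ⊗ₘ g) ≫ conv φ ψ = conv (F.map f ≫ φ) (F.map g ≫ ψ) := by
  simp only [conv, comp_lift_assoc, ← Functor.map_comp_assoc, tensorHom_fst, tensorHom_snd]

/-- Associativity of `N` on generalised elements; it is what makes the associator of the fibre
exist. -/
theorem map_associator_conv {X Y Z : U} (φ : F.obj X ⟶ N) (ψ : F.obj Y ⟶ N) (χ : F.obj Z ⟶ N) :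
    F.map (α_ X Y Z).hom ≫ conv φ (conv ψ χ) = conv (conv φ ψ) χ := by
  simp only [conv, comp_lift_assoc, ← Functor.map_comp_assoc, associator_hom_fst,
    associator_hom_snd_fst, associator_hom_snd_snd]
  simp [MonObj.lift_lift_assoc]

theorem map_leftUnitor_conv {X : U} (φ : F.obj X ⟶ N) :
    F.map (λ_ X).hom ≫ φ = conv (oneBase F N) φ := by
  simp only [conv, oneBase, leftUnitor_hom]
  simp

theorem map_rightUnitor_conv {X : U} (φ : F.obj X ⟶ N) :
    F.map (ρ_ X).hom ≫ φ = conv φ (oneBase F N) := by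
  simp only [conv, oneBase, rightUnitor_hom]
  simp

theorem map_braiding_conv [BraidedCategory U]
    (hN : ∀ (Z : V) (a b : Z ⟶ N), lift a b ≫ MonObj.mul = lift b a ≫ MonObj.mul)
    {X Y : U} (φ : F.obj X ⟶ N) (ψ : F.obj Y ⟶ N) :
    F.map (β_ X Y).hom ≫ conv ψ φ = conv φ ψ := by
  simp only [conv, comp_lift_assoc, ← Functor.map_comp_assoc, braiding_hom_fst, braiding_hom_snd]
  exact hN _ _ _

end Convolution

/-! ### The monoidal structure of the fibre -/

section Tensor

variable {U : Type u₁} [Category.{v₁} U] [CartesianMonoidalCategory U]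
  {V : Type u₂} [Category.{v₂} V] [CartesianMonoidalCategory V] {F : U ⥤ V} {N : V} [MonObj N]
  [CofibredInGroupoids F]

variable (F N) in
/-- The unit of the fibre. -/
def tensorUnit : F.Fiber N := (exists_baseMap_eq (oneBase F N)).choose

variable (F N) in
/-- The cocartesian morphism to the unit of the fibre. -/
def unitMap : 𝟙_ U ⟶ fiberInclusion.obj (tensorUnit F N) :=
  (exists_baseMap_eq (oneBase F N)).choose_spec.choose

theorem baseMap_unitMap : baseMap (unitMap F N) = oneBase F N :=
  (exists_baseMap_eq (oneBase F N)).choose_spec.choose_spec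

/-- The tensor product of two objects of the fibre. -/
def tensorObj (A B : F.Fiber N) : F.Fiber N := (exists_baseMap_eq (mulBase F N A B)).choose

/-- The cocartesian morphism to the tensor product of two objects of the fibre. -/
def tensorMap (A B : F.Fiber N) :
    fiberInclusion.obj A ⊗ fiberInclusion.obj B ⟶ fiberInclusion.obj (tensorObj A B) :=
  (exists_baseMap_eq (mulBase F N A B)).choose_spec.choose

theorem baseMap_tensorMap (A B : F.Fiber N) : baseMap (tensorMap A B) = mulBase F N A B :=
  (exists_baseMap_eq (mulBase F N A B)).choose_spec.choose_spec

/-- The morphism to a tensor product of the fibre induced by morphisms to the factors. -/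
def pair {X Y : U} {A B : F.Fiber N} (f : X ⟶ fiberInclusion.obj A)
    (g : Y ⟶ fiberInclusion.obj B) : X ⊗ Y ⟶ fiberInclusion.obj (tensorObj A B) :=
  (f ⊗ₘ g) ≫ tensorMap A B

theorem baseMap_pair {X Y : U} {A B : F.Fiber N} (f : X ⟶ fiberInclusion.obj A)
    (g : Y ⟶ fiberInclusion.obj B) : baseMap (pair f g) = conv (baseMap f) (baseMap g) := by
  rw [pair, baseMap_comp, baseMap_tensorMap]
  exact map_tensor_conv f g _ _

@[simp]
theorem tensor_comp_pair {X X' Y Y' : U} {A B : F.Fiber N} (h : X ⟶ X') (k : Y ⟶ Y')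
    (f : X' ⟶ fiberInclusion.obj A) (g : Y' ⟶ fiberInclusion.obj B) :
    (h ⊗ₘ k) ≫ pair f g = pair (h ≫ f) (k ≫ g) := by
  simp [pair]

@[simp]
theorem whiskerLeft_comp_pair {X Y Y' : U} {A B : F.Fiber N} (k : Y ⟶ Y')
    (f : X ⟶ fiberInclusion.obj A) (g : Y' ⟶ fiberInclusion.obj B) :
    X ◁ k ≫ pair f g = pair f (k ≫ g) := by
  rw [← id_tensorHom, tensor_comp_pair, Category.id_comp]

@[simp]
theorem whiskerLeft_comp_pair_assoc {X Y Y' : U} {A B : F.Fiber N} (k : Y ⟶ Y')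
    (f : X ⟶ fiberInclusion.obj A) (g : Y' ⟶ fiberInclusion.obj B)
    {W : U} (z : _ ⟶ W) :
    X ◁ k ≫ pair f g ≫ z = pair f (k ≫ g) ≫ z := by
  simpa only [Category.assoc] using whiskerLeft_comp_pair _ _ _ =≫ z

@[simp]
theorem whiskerRight_comp_pair {X X' Y : U} {A B : F.Fiber N} (h : X ⟶ X')
    (f : X' ⟶ fiberInclusion.obj A) (g : Y ⟶ fiberInclusion.obj B) :
    h ▷ Y ≫ pair f g = pair (h ≫ f) g := by
  rw [← tensorHom_id, tensor_comp_pair, Category.id_comp]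

@[simp]
theorem whiskerRight_comp_pair_assoc {X X' Y : U} {A B : F.Fiber N} (h : X ⟶ X')
    (f : X' ⟶ fiberInclusion.obj A) (g : Y ⟶ fiberInclusion.obj B)
    {W : U} (z : _ ⟶ W) :
    h ▷ Y ≫ pair f g ≫ z = pair (h ≫ f) g ≫ z := by
  simpa only [Category.assoc] using whiskerRight_comp_pair _ _ _ =≫ z

/-- Factoring through the pair of identities extends the defining equation of a fibre morphism from
that one pair to all pairs. The resulting rules can then rewrite inside nested pairs. -/
theorem pair_eq_tensor_comp {X Y : U} {A B : F.Fiber N} (f : X ⟶ fiberInclusion.obj A)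
    (g : Y ⟶ fiberInclusion.obj B) : pair f g = (f ⊗ₘ g) ≫ pair (𝟙 _) (𝟙 _) := by
  simp

theorem pair_pair_eq_tensor_comp {X Y Z : U} {A B C : F.Fiber N} (f : X ⟶ fiberInclusion.obj A)
    (g : Y ⟶ fiberInclusion.obj B) (h : Z ⟶ fiberInclusion.obj C) :
    pair (pair f g) h = ((f ⊗ₘ g) ⊗ₘ h) ≫ pair (pair (𝟙 _) (𝟙 _)) (𝟙 _) := by
  rw [tensor_comp_pair, tensor_comp_pair]
  simp only [Category.comp_id]

/-- The tensor product of morphisms of the fibre. -/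
def tensorHom {A A' B B' : F.Fiber N} (f : A ⟶ A') (g : B ⟶ B') :
    tensorObj A B ⟶ tensorObj A' B' :=
  -- The composites with identities are left unsimplified so that `baseMap_comp_map` applies to each
  -- factor.
  desc (pair (𝟙 _) (𝟙 _)) (pair (𝟙 _ ≫ fiberInclusion.map f) (𝟙 _ ≫ fiberInclusion.map g))
    (by simp only [baseMap_pair, baseMap_comp_map])

@[simp]
theorem pair_comp_tensorHom {X Y : U} {A A' B B' : F.Fiber N} (f : X ⟶ fiberInclusion.obj A)
    (g : Y ⟶ fiberInclusion.obj B) (f' : A ⟶ A') (g' : B ⟶ B') :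
    pair f g ≫ fiberInclusion.map (tensorHom f' g') =
      pair (f ≫ fiberInclusion.map f') (g ≫ fiberInclusion.map g') := by
  rw [pair_eq_tensor_comp f g, Category.assoc, tensorHom, fac]
  simp

@[simp]
theorem pair_comp_tensorHom_assoc {X Y : U} {A A' B B' : F.Fiber N} (f : X ⟶ fiberInclusion.obj A)
    (g : Y ⟶ fiberInclusion.obj B) (f' : A ⟶ A') (g' : B ⟶ B')
    {W : U} (z : _ ⟶ W) :
    pair f g ≫ fiberInclusion.map (tensorHom f' g') ≫ z =
      pair (f ≫ fiberInclusion.map f') (g ≫ fiberInclusion.map g') ≫ z := by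
  simpa only [Category.assoc] using pair_comp_tensorHom _ _ _ _ =≫ z

/-- The associator of the fibre. -/
def assoc (A B C : F.Fiber N) :
    tensorObj (tensorObj A B) C ≅ tensorObj A (tensorObj B C) :=
  descIso (pair (pair (𝟙 _) (𝟙 _)) (𝟙 _)) ((α_ _ _ _).hom ≫ pair (𝟙 _) (pair (𝟙 _) (𝟙 _)))
    (by simp only [baseMap_comp, baseMap_pair, map_associator_conv])

@[simp]
theorem pair_comp_assoc {X Y Z : U} {A B C : F.Fiber N} (f : X ⟶ fiberInclusion.obj A)
    (g : Y ⟶ fiberInclusion.obj B) (h : Z ⟶ fiberInclusion.obj C) :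
    pair (pair f g) h ≫ fiberInclusion.map (assoc A B C).hom =
      (α_ _ _ _).hom ≫ pair f (pair g h) := by
  rw [pair_pair_eq_tensor_comp, Category.assoc, assoc, comp_descIso_hom,
    associator_naturality_assoc, tensor_comp_pair, tensor_comp_pair]
  simp only [Category.comp_id]

@[simp]
theorem pair_comp_assoc_assoc {X Y Z : U} {A B C : F.Fiber N} (f : X ⟶ fiberInclusion.obj A)
    (g : Y ⟶ fiberInclusion.obj B) (h : Z ⟶ fiberInclusion.obj C)
    {W : U} (z : _ ⟶ W) :
    pair (pair f g) h ≫ fiberInclusion.map (assoc A B C).hom ≫ z =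
      (α_ _ _ _).hom ≫ pair f (pair g h) ≫ z := by
  simpa only [Category.assoc] using pair_comp_assoc _ _ _ =≫ z

/-- The left unitor of the fibre. -/
def leftUnit (A : F.Fiber N) : tensorObj (tensorUnit F N) A ≅ A :=
  descIso (pair (unitMap F N) (𝟙 _)) ((λ_ _).hom ≫ 𝟙 _)
    (by rw [baseMap_comp, baseMap_pair, map_leftUnitor_conv, baseMap_unitMap])

@[simp]
theorem pair_comp_assoc_inv {X Y Z : U} {A B C : F.Fiber N} (f : X ⟶ fiberInclusion.obj A)
    (g : Y ⟶ fiberInclusion.obj B) (h : Z ⟶ fiberInclusion.obj C) :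
    pair f (pair g h) ≫ fiberInclusion.map (assoc A B C).inv =
      (α_ _ _ _).inv ≫ pair (pair f g) h := by
  rw [Iso.eq_inv_comp, ← pair_comp_assoc_assoc, ← Functor.map_comp, Iso.hom_inv_id,
    CategoryTheory.Functor.map_id, Category.comp_id]

@[simp]
theorem pair_comp_assoc_inv_assoc {X Y Z : U} {A B C : F.Fiber N} (f : X ⟶ fiberInclusion.obj A)
    (g : Y ⟶ fiberInclusion.obj B) (h : Z ⟶ fiberInclusion.obj C)
    {W : U} (z : _ ⟶ W) :
    pair f (pair g h) ≫ fiberInclusion.map (assoc A B C).inv ≫ z =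
      (α_ _ _ _).inv ≫ pair (pair f g) h ≫ z := by
  simpa only [Category.assoc] using pair_comp_assoc_inv _ _ _ =≫ z

@[simp]
theorem pair_comp_leftUnit {X : U} {A : F.Fiber N} (f : X ⟶ fiberInclusion.obj A) :
    pair (unitMap F N) f ≫ fiberInclusion.map (leftUnit A).hom = (λ_ _).hom ≫ f := by
  have h : pair (unitMap F N) f = (𝟙 _ ⊗ₘ f) ≫ pair (unitMap F N) (𝟙 _) := by
    rw [tensor_comp_pair, Category.id_comp, Category.comp_id]
  rw [h, Category.assoc, leftUnit, comp_descIso_hom]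
  simp

@[simp]
theorem pair_comp_leftUnit_assoc {X : U} {A : F.Fiber N} (f : X ⟶ fiberInclusion.obj A)
    {W : U} (z : _ ⟶ W) :
    pair (unitMap F N) f ≫ fiberInclusion.map (leftUnit A).hom ≫ z = (λ_ _).hom ≫ f ≫ z := by
  simpa only [Category.assoc] using pair_comp_leftUnit _ =≫ z

/-- The right unitor of the fibre. -/
def rightUnit (A : F.Fiber N) : tensorObj A (tensorUnit F N) ≅ A :=
  descIso (pair (𝟙 _) (unitMap F N)) ((ρ_ _).hom ≫ 𝟙 _)
    (by rw [baseMap_comp, baseMap_pair, map_rightUnitor_conv, baseMap_unitMap])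

@[simp]
theorem pair_comp_rightUnit {X : U} {A : F.Fiber N} (f : X ⟶ fiberInclusion.obj A) :
    pair f (unitMap F N) ≫ fiberInclusion.map (rightUnit A).hom = (ρ_ _).hom ≫ f := by
  have h : pair f (unitMap F N) = (f ⊗ₘ 𝟙 _) ≫ pair (𝟙 _) (unitMap F N) := by
    rw [tensor_comp_pair, Category.id_comp, Category.comp_id]
  rw [h, Category.assoc, rightUnit, comp_descIso_hom]
  simp

@[simp]
theorem pair_comp_rightUnit_assoc {X : U} {A : F.Fiber N} (f : X ⟶ fiberInclusion.obj A)
    {W : U} (z : _ ⟶ W) :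
    pair f (unitMap F N) ≫ fiberInclusion.map (rightUnit A).hom ≫ z = (ρ_ _).hom ≫ f ≫ z := by
  simpa only [Category.assoc] using pair_comp_rightUnit _ =≫ z

variable (F N) in
/-- The tensor product of the fibre. -/
abbrev monoidalStruct : MonoidalCategoryStruct (F.Fiber N) where
  tensorObj := tensorObj
  whiskerLeft A _ _ f := tensorHom (𝟙 A) f
  whiskerRight f B := tensorHom f (𝟙 B)
  tensorHom := tensorHom
  tensorUnit := tensorUnit F N
  associator := assoc
  leftUnitor := leftUnit
  rightUnitor := rightUnit

variable (F N) in
/-- The monoidal structure of the fibre. -/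
abbrev monoidal : MonoidalCategory (F.Fiber N) :=
  letI := monoidalStruct F N
  .ofTensorHom
    -- Each axiom is tested on the iterated `pair` of identities and unit maps into its source; the
    -- `pair_comp_*` rules turn it into the same axiom for products in `U`.
    (id_tensorHom_id := fun _ _ => hom_ext (pair (𝟙 _) (𝟙 _))
      ((pair_comp_tensorHom _ _ _ _).trans (by
        simp
        exact (Category.comp_id _).symm)))
    (id_tensorHom := fun _ _ _ _ => rfl)
    (tensorHom_id := fun _ _ => rfl)
    (tensorHom_comp_tensorHom := fun f₁ f₂ g₁ g₂ => hom_ext (pair (𝟙 _) (𝟙 _)) (by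
      change _ ≫ fiberInclusion.map (tensorHom f₁ f₂ ≫ tensorHom g₁ g₂) =
        _ ≫ fiberInclusion.map (tensorHom (f₁ ≫ g₁) (f₂ ≫ g₂))
      simp))
    (associator_naturality := fun {A₁ A₂ A₃ B₁ B₂ B₃} f₁ f₂ f₃ =>
      hom_ext (pair (pair (𝟙 _) (𝟙 _)) (𝟙 _)) (by
        change _ ≫ fiberInclusion.map (tensorHom (tensorHom f₁ f₂) f₃ ≫ (assoc B₁ B₂ B₃).hom) =
          _ ≫ fiberInclusion.map ((assoc A₁ A₂ A₃).hom ≫ tensorHom f₁ (tensorHom f₂ f₃))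
        simp))
    (leftUnitor_naturality := fun {A B} f => hom_ext (pair (unitMap F N) (𝟙 _)) (by
      change _ ≫ fiberInclusion.map (tensorHom (𝟙 _) f ≫ (leftUnit B).hom) =
        _ ≫ fiberInclusion.map ((leftUnit A).hom ≫ f)
      simp))
    (rightUnitor_naturality := fun {A B} f => hom_ext (pair (𝟙 _) (unitMap F N)) (by
      change _ ≫ fiberInclusion.map (tensorHom f (𝟙 _) ≫ (rightUnit B).hom) =
        _ ≫ fiberInclusion.map ((rightUnit A).hom ≫ f)
      simp))
    (pentagon := fun A B C D => hom_ext (pair (pair (pair (𝟙 _) (𝟙 _)) (𝟙 _)) (𝟙 _)) (by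
      change _ ≫ fiberInclusion.map (tensorHom (assoc A B C).hom (𝟙 D) ≫
          (assoc A (tensorObj B C) D).hom ≫ tensorHom (𝟙 A) (assoc B C D).hom) =
        _ ≫ fiberInclusion.map ((assoc (tensorObj A B) C D).hom ≫
          (assoc A B (tensorObj C D)).hom)
      -- Used from right to left, these pull the associators of `U` out of the pairs, so that the
      -- pentagon of `U` becomes visible.
      have h₁ := whiskerRight_comp_pair (α_ (fiberInclusion.obj A) (fiberInclusion.obj B)
        (fiberInclusion.obj C)).hom (pair (𝟙 _) (pair (𝟙 _) (𝟙 _))) (𝟙 (fiberInclusion.obj D))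
      have h₂ := whiskerLeft_comp_pair (α_ (fiberInclusion.obj B) (fiberInclusion.obj C)
        (fiberInclusion.obj D)).hom (𝟙 (fiberInclusion.obj A)) (pair (𝟙 _) (pair (𝟙 _) (𝟙 _)))
      simp [← h₁, ← h₂, -whiskerLeft_comp_pair, -whiskerRight_comp_pair]))
    (triangle := fun A B => hom_ext (pair (pair (𝟙 _) (unitMap F N)) (𝟙 _)) (by
      change _ ≫ fiberInclusion.map ((assoc A (tensorUnit F N) B).hom ≫
          tensorHom (𝟙 A) (leftUnit B).hom) =
        _ ≫ fiberInclusion.map (tensorHom (rightUnit A).hom (𝟙 B))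
      have h₁ := whiskerLeft_comp_pair (λ_ (fiberInclusion.obj B)).hom
        (𝟙 (fiberInclusion.obj A)) (𝟙 _)
      have h₂ := whiskerRight_comp_pair (ρ_ (fiberInclusion.obj A)).hom (𝟙 _)
        (𝟙 (fiberInclusion.obj B))
      rw [Category.comp_id] at h₁ h₂
      simp [← h₁, ← h₂, -whiskerLeft_comp_pair, -whiskerRight_comp_pair]))

variable (F N) in
/-- The inclusion of the fibre is lax monoidal. -/
abbrev laxMonoidal :
    letI := monoidal F N
    (fiberInclusion : F.Fiber N ⥤ U).LaxMonoidal :=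
  letI := monoidal F N
  { ε := unitMap F N
    μ := fun _ _ => pair (𝟙 _) (𝟙 _)
    μ_natural_left := fun f B => by
      change _ = pair _ _ ≫ fiberInclusion.map (tensorHom f (𝟙 B))
      simp
    μ_natural_right := fun B f => by
      change _ = pair _ _ ≫ fiberInclusion.map (tensorHom (𝟙 B) f)
      simp
    associativity := fun A B C => by
      change _ ≫ pair _ _ ≫ fiberInclusion.map (assoc A B C).hom = _
      simp
    left_unitality := fun A => by
      change _ = _ ≫ pair _ _ ≫ fiberInclusion.map (leftUnit A).hom
      simp
    right_unitality := fun A => by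
      change _ = _ ≫ pair _ _ ≫ fiberInclusion.map (rightUnit A).hom
      simp }

/-! ### The symmetry of the fibre -/

variable [BraidedCategory U]

/-- Commutativity of an internal monoid, on generalised elements. -/
def IsComm (N : V) [MonObj N] : Prop :=
  ∀ (Z : V) (a b : Z ⟶ N), lift a b ≫ MonObj.mul = lift b a ≫ MonObj.mul

/-- The symmetry of the fibre. -/
def braid (hN : IsComm N) (A B : F.Fiber N) : tensorObj A B ≅ tensorObj B A :=
  descIso (pair (𝟙 _) (𝟙 _)) ((β_ _ _).hom ≫ pair (𝟙 _) (𝟙 _))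
    (by rw [baseMap_comp, baseMap_pair, map_braiding_conv hN, baseMap_pair])

@[simp]
theorem pair_comp_braid (hN : IsComm N) {X Y : U} {A B : F.Fiber N}
    (f : X ⟶ fiberInclusion.obj A) (g : Y ⟶ fiberInclusion.obj B) :
    pair f g ≫ fiberInclusion.map (braid hN A B).hom = (β_ _ _).hom ≫ pair g f := by
  rw [pair_eq_tensor_comp, Category.assoc, braid, comp_descIso_hom,
    BraidedCategory.braiding_naturality_assoc, tensor_comp_pair]
  simp only [Category.comp_id]

@[simp]
theorem pair_comp_braid_assoc (hN : IsComm N) {X Y : U} {A B : F.Fiber N}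
    (f : X ⟶ fiberInclusion.obj A) (g : Y ⟶ fiberInclusion.obj B)
    {W : U} (z : _ ⟶ W) :
    pair f g ≫ fiberInclusion.map (braid hN A B).hom ≫ z = (β_ _ _).hom ≫ pair g f ≫ z := by
  simpa only [Category.assoc] using pair_comp_braid _ _ _ =≫ z

/-- The symmetry of the fibre makes it a symmetric monoidal category. -/
abbrev symmetric (hN : IsComm N) :
    letI := monoidal F N
    SymmetricCategory (F.Fiber N) :=
  letI := monoidal F N
  { braiding := braid hN
    braiding_naturality_right := fun A {B C} f => hom_ext (pair (𝟙 _) (𝟙 _)) (by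
      change _ ≫ fiberInclusion.map (tensorHom (𝟙 A) f ≫ (braid hN A C).hom) =
        _ ≫ fiberInclusion.map ((braid hN A B).hom ≫ tensorHom f (𝟙 A))
      simp)
    braiding_naturality_left := fun {B C} f A => hom_ext (pair (𝟙 _) (𝟙 _)) (by
      change _ ≫ fiberInclusion.map (tensorHom f (𝟙 A) ≫ (braid hN C A).hom) =
        _ ≫ fiberInclusion.map ((braid hN B A).hom ≫ tensorHom (𝟙 A) f)
      simp)
    hexagon_forward := fun A B C => hom_ext (pair (pair (𝟙 _) (𝟙 _)) (𝟙 _)) (by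
      change _ ≫ fiberInclusion.map ((assoc A B C).hom ≫ (braid hN A (tensorObj B C)).hom ≫
          (assoc B C A).hom) =
        _ ≫ fiberInclusion.map (tensorHom (braid hN A B).hom (𝟙 C) ≫ (assoc B A C).hom ≫
          tensorHom (𝟙 B) (braid hN A C).hom)
      have h₁ := whiskerLeft_comp_pair (β_ (fiberInclusion.obj A) (fiberInclusion.obj C)).hom
        (𝟙 (fiberInclusion.obj B)) (pair (𝟙 _) (𝟙 _))
      have h₂ := whiskerRight_comp_pair (β_ (fiberInclusion.obj A) (fiberInclusion.obj B)).hom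
        (pair (𝟙 _) (𝟙 _)) (𝟙 (fiberInclusion.obj C))
      simp [← h₁, ← h₂, -whiskerLeft_comp_pair, -whiskerRight_comp_pair])
    -- The source here is bracketed to the right, so the test morphism is nested on the right as
    -- well.
    hexagon_reverse := fun A B C => hom_ext (pair (𝟙 _) (pair (𝟙 _) (𝟙 _))) (by
      change _ ≫ fiberInclusion.map ((assoc A B C).inv ≫ (braid hN (tensorObj A B) C).hom ≫
          (assoc C A B).inv) =
        _ ≫ fiberInclusion.map (tensorHom (𝟙 A) (braid hN B C).hom ≫ (assoc A C B).inv ≫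
          tensorHom (braid hN A C).hom (𝟙 B))
      have h₁ := whiskerLeft_comp_pair (β_ (fiberInclusion.obj B) (fiberInclusion.obj C)).hom
        (𝟙 (fiberInclusion.obj A)) (pair (𝟙 _) (𝟙 _))
      have h₂ := whiskerRight_comp_pair (β_ (fiberInclusion.obj A) (fiberInclusion.obj C)).hom
        (pair (𝟙 _) (𝟙 _)) (𝟙 (fiberInclusion.obj B))
      simp [← h₁, ← h₂, -whiskerLeft_comp_pair, -whiskerRight_comp_pair])
    symmetry := fun A B => hom_ext (pair (𝟙 _) (𝟙 _)) (by
      change _ ≫ fiberInclusion.map ((braid hN A B).hom ≫ (braid hN B A).hom) =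
        _ ≫ fiberInclusion.map (𝟙 _)
      simp) }

variable (F) in
/-- The symmetric monoidal structure of the fibre over a commutative internal monoid. -/
def fibreTensor (hN : IsComm N) : FibreTensor F N :=
  letI := monoidal F N
  letI := symmetric (F := F) hN
  { monoidal := monoidal F N
    symmetric := symmetric hN
    lax :=
      { __ := laxMonoidal F N
        braided := fun A B =>
          pair_comp_braid hN (𝟙 (fiberInclusion.obj A)) (𝟙 (fiberInclusion.obj B)) }
    unit_cocartesian := by
      rw [← baseMap_unitMap]
      exact isStronglyCocartesian_baseMap (unitMap F N)
    tensor_cocartesian := fun A B => by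
      have h : baseMap (pair (𝟙 (fiberInclusion.obj A)) (𝟙 (fiberInclusion.obj B))) =
          mulBase F N A B := by
        simp [pair, baseMap_tensorMap]
        rfl
      rw [← h]
      exact isStronglyCocartesian_baseMap
        (pair (𝟙 (fiberInclusion.obj A)) (𝟙 (fiberInclusion.obj B))) }

end Tensor

end CofibredInGroupoids

/-! ### Uniqueness of the symmetric monoidal structure up to unique comparison -/

namespace FibreTensor

open CofibredInGroupoids

variable {U : Type u₁} [Category.{v₁} U] [CartesianMonoidalCategory U] [BraidedCategory U]
  {V : Type u₂} [Category.{v₂} V] [CartesianMonoidalCategory V] {F : U ⥤ V} {N : V} [MonObj N]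

section

variable (T : FibreTensor F N)

/-- Of the cocartesianness of `ε`, only the fact that it lies over `oneBase F N` is extracted: the
universal property is automatic when `F` is cofibred in groupoids. -/
theorem baseMap_ε :
    baseMap (F := F) (N := N) (A := (𝟙_ T.Carrier : T.Carrier)) (ε T.incl) = oneBase F N := by
  have : F.IsHomLift (oneBase F N) (ε T.incl) := T.unit_cocartesian.toIsHomLift
  exact ((IsHomLift.fac F (oneBase F N) (ε T.incl)).trans (Category.id_comp _)).symm

theorem baseMap_μ (A B : T.Carrier) :
    baseMap (F := F) (N := N) (A := (A ⊗ B : T.Carrier)) (μ T.incl A B) = mulBase F N A B := by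
  have : F.IsHomLift (mulBase F N A B) (μ T.incl A B) :=
    (T.tensor_cocartesian A B).toIsHomLift
  exact ((IsHomLift.fac F (mulBase F N A B) (μ T.incl A B)).trans (Category.id_comp _)).symm

variable [CofibredInGroupoids F]

variable {T} in
-- A version of `hom_ext` on the type synonym, where the tensor product of `T` is the one found by
-- instance search.
theorem carrier_hom_ext {X : U} {A B : T.Carrier} (w : X ⟶ T.incl.obj A) {f g : A ⟶ B}
    (h : w ≫ T.incl.map f = w ≫ T.incl.map g) : f = g :=
  hom_ext (F := F) (N := N) w h

end

variable [CofibredInGroupoids F] (T T' : FibreTensor F N)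

/-- The comparison of the units. -/
def compareUnit : 𝟙_ T'.Carrier ≅ (idFunctor T T').obj (𝟙_ T.Carrier) :=
  descIso (F := F) (N := N) (ε T'.incl) (ε T.incl) ((baseMap_ε T).trans (baseMap_ε T').symm)

theorem ε_comp_compareUnit :
    ε T'.incl ≫ T'.incl.map (compareUnit T T').hom = ε T.incl :=
  comp_descIso_hom (F := F) (N := N) _ _ _

/-- The comparison of the tensor products. -/
def compareTensor (A B : T.Carrier) :
    (idFunctor T T').obj A ⊗ (idFunctor T T').obj B ≅ (idFunctor T T').obj (A ⊗ B) :=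
  descIso (F := F) (N := N) (μ T'.incl ((idFunctor T T').obj A) ((idFunctor T T').obj B))
    (μ T.incl A B) ((baseMap_μ T A B).trans (baseMap_μ T' _ _).symm)

theorem μ_comp_compareTensor (A B : T.Carrier) :
    μ T'.incl ((idFunctor T T').obj A) ((idFunctor T T').obj B) ≫
      T'.incl.map (compareTensor T T' A B).hom = μ T.incl A B :=
  comp_descIso_hom (F := F) (N := N) _ _ _

theorem μ_comp_compareTensor_assoc (A B : T.Carrier) {Z : U} (h : T.incl.obj (A ⊗ B) ⟶ Z) :
    μ T'.incl ((idFunctor T T').obj A) ((idFunctor T T').obj B) ≫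
      T'.incl.map (compareTensor T T' A B).hom ≫ h = μ T.incl A B ≫ h := by
  rw [← μ_comp_compareTensor T T']
  exact (Category.assoc _ _ _).symm

/-- The comparison of two symmetric monoidal structures on the fibre. -/
def compareMonoidal : (idFunctor T T').CoreMonoidal where
  εIso := compareUnit T T'
  μIso := compareTensor T T'
  μIso_hom_natural_left {A B} f C := carrier_hom_ext (μ T'.incl _ _) (by
    rw [Functor.map_comp, ← μ_natural_left_assoc, μ_comp_compareTensor, Functor.map_comp]
    exact (μ_natural_left T.incl f C).trans
      (μ_comp_compareTensor_assoc T T' A C (T.incl.map (f ▷ C))).symm)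
  μIso_hom_natural_right {A B} C f := carrier_hom_ext (μ T'.incl _ _) (by
    rw [Functor.map_comp, ← μ_natural_right_assoc, μ_comp_compareTensor, Functor.map_comp]
    exact (μ_natural_right T.incl C f).trans
      (μ_comp_compareTensor_assoc T T' C A (T.incl.map (C ◁ f))).symm)
  associativity A B C := carrier_hom_ext (μ T'.incl _ _ ▷ _ ≫ μ T'.incl _ _) (by
    -- Precomposed with the maps of `T'`, both sides reduce to expressions in the maps of `T` alone,
    -- which agree because `T.incl` is lax monoidal. The unit laws follow the same pattern.
    trans μ T.incl A B ▷ T.incl.obj C ≫ μ T.incl (A ⊗ B) C ≫ T.incl.map (α_ A B C).hom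
    · rw [Functor.map_comp, Functor.map_comp, Category.assoc, ← μ_natural_left_assoc,
        ← comp_whiskerRight_assoc, μ_comp_compareTensor]
      exact congrArg (μ T.incl A B ▷ T.incl.obj C ≫ ·)
        (μ_comp_compareTensor_assoc T T' (A ⊗ B) C (T.incl.map (α_ A B C).hom))
    · rw [Functor.map_comp, Functor.map_comp, Category.assoc, associativity_assoc,
        ← μ_natural_right_assoc, ← MonoidalCategory.whiskerLeft_comp_assoc, μ_comp_compareTensor,
        μ_comp_compareTensor]
      exact associativity T.incl A B C)
  left_unitality A := carrier_hom_ext (ε T'.incl ▷ _ ≫ μ T'.incl _ _) (by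
    trans ε T.incl ▷ T.incl.obj A ≫ μ T.incl (𝟙_ _) A ≫ T.incl.map (λ_ A).hom
    · rw [Category.assoc, ← left_unitality]
      exact left_unitality T.incl A
    · rw [Functor.map_comp, Functor.map_comp, Category.assoc, ← μ_natural_left_assoc,
        ← comp_whiskerRight_assoc, ε_comp_compareUnit]
      exact congrArg (ε T.incl ▷ T.incl.obj A ≫ ·)
        (μ_comp_compareTensor_assoc T T' (𝟙_ _) A (T.incl.map (λ_ A).hom)).symm)
  right_unitality A := carrier_hom_ext (_ ◁ ε T'.incl ≫ μ T'.incl _ _) (by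
    trans T.incl.obj A ◁ ε T.incl ≫ μ T.incl A (𝟙_ _) ≫ T.incl.map (ρ_ A).hom
    · rw [Category.assoc, ← right_unitality]
      exact right_unitality T.incl A
    · rw [Functor.map_comp, Functor.map_comp, Category.assoc, ← μ_natural_right_assoc,
        ← MonoidalCategory.whiskerLeft_comp_assoc, ε_comp_compareUnit]
      exact congrArg (T.incl.obj A ◁ ε T.incl ≫ ·)
        (μ_comp_compareTensor_assoc T T' A (𝟙_ _) (T.incl.map (ρ_ A).hom)).symm)

theorem compareTensor_braided (A B : T.Carrier) :
    (compareTensor T T' A B).hom ≫ (idFunctor T T').map (β_ A B).hom =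
      (β_ ((idFunctor T T').obj A) ((idFunctor T T').obj B)).hom ≫
        (compareTensor T T' B A).hom :=
  carrier_hom_ext (μ T'.incl _ _) (by
    rw [Functor.map_comp, Functor.map_comp, Functor.LaxBraided.braided_assoc,
      μ_comp_compareTensor]
    exact (μ_comp_compareTensor_assoc T T' A B (T.incl.map (β_ A B).hom)).trans
      (Functor.LaxBraided.braided (F := T.incl) A B))

/-- The comparison of two symmetric monoidal structures on the fibre. -/
def compare : Comparison T T' :=
  letI : (idFunctor T T').Braided :=
    { __ := (compareMonoidal T T').toMonoidal
      braided := compareTensor_braided T T' }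
  { unit_comp := ε_comp_compareUnit T T'
    tensor_comp := μ_comp_compareTensor T T' }

theorem leftInverse_eq_rightInverse {C : Type u₁} [Category.{v₁} C] {X Y : C}
    {f : X ⟶ Y} {g g' : Y ⟶ X}
    (h : g ≫ f = 𝟙 Y) (h' : f ≫ g' = 𝟙 X) : g = g' := by
  rw [← Category.comp_id g, ← h', ← Category.assoc, h, Category.id_comp]

variable {T T'} in
-- Compatibility with the cocartesian morphisms determines `ε` and `μ`; the remaining data `η` and
-- `δ` are their inverses.
theorem Comparison.eq (c c' : Comparison T T') : c = c' := by
  obtain ⟨h₁, h₂⟩ := c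
  rename_i b
  obtain ⟨h₁', h₂'⟩ := c'
  rename_i b'
  have hb : b = b' := by
    have hε : b.toMonoidal.toLaxMonoidal.ε = b'.toMonoidal.toLaxMonoidal.ε :=
      carrier_hom_ext (ε T'.incl) (h₁.trans h₁'.symm)
    have hμ : b.toMonoidal.toLaxMonoidal.μ = b'.toMonoidal.toLaxMonoidal.μ :=
      funext₂ fun A B => carrier_hom_ext (μ T'.incl _ _) ((h₂ A B).trans (h₂' A B).symm)
    refine Functor.Braided.ext hε hμ ?_ (funext₂ fun A B => ?_)
    · exact leftInverse_eq_rightInverse b.toMonoidal.η_ε (hε ▸ b'.toMonoidal.ε_η)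
    · exact leftInverse_eq_rightInverse (b.toMonoidal.δ_μ A B) (hμ ▸ b'.toMonoidal.μ_δ A B)
  subst hb
  rfl

/-- There is exactly one comparison of two symmetric monoidal structures on the fibre. -/
theorem nonempty_unique_comparison : Nonempty (Unique (Comparison T T')) :=
  ⟨⟨⟨compare T T'⟩, fun c => c.eq _⟩⟩

end FibreTensor

variable {M : Type u} [Monoid M]

/-! ### Every morphism of Schreier extensions is cocartesian -/

namespace Ext

/-- Translating by the invertible element `a` only shifts all coefficients by its inverse `b`, so
existence and uniqueness of coefficients survive. -/
theorem IsRep.add_left {E : Ext M} {m : M} {u : E.X} (hu : E.IsRep m u) {a b : E.K}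
    (h : b + a = 0) : E.IsRep m (E.k a + u) := by
  refine ⟨by rw [map_add, f_k, zero_add, hu.1], fun x hx => ?_⟩
  obtain ⟨c, rfl, -⟩ := hu.2 x hx
  refine ⟨c + b, ?_, fun d hd => ?_⟩
  · change _ = _
    rw [← add_assoc, ← map_add, add_assoc, h, add_zero]
  · change _ = _ at hd
    rw [← add_assoc, ← map_add] at hd
    rw [hu.unique hd, add_assoc, add_comm a, h, add_zero]

theorem exists_eq_add {E E' : Ext M} (hE : E.IsSchreier) (f : E ⟶ E') (x : E'.X) :
    ∃ (a : E'.K) (u : E.X) (m : M), E.IsRep m u ∧ x = E'.k a + f.mid u := by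
  obtain ⟨u, hu⟩ := hE (E'.f x).toMul
  obtain ⟨a, ha, -⟩ := (f.isRep_mid _ u hu).2 x rfl
  exact ⟨a, u, _, hu, ha⟩

/-- Well-definedness of `k a + f u ↦ k (g a) + ψ u`. Expressing `u` and `v` through a representative
`w` of their common image turns the hypothesis into an equality of coefficients of the
representative `f w`, to which `g` is applied. -/
theorem add_mid_eq {E E' Z : Ext M} (hE : E.IsSchreier) (f : E ⟶ E') (ψ : E ⟶ Z)
    (g : E'.K →+ Z.K) (h : ∀ a, g (f.left a) = ψ.left a) {a b : E'.K} {u v : E.X}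
    (hx : E'.k a + f.mid u = E'.k b + f.mid v) :
    Z.k (g a) + ψ.mid u = Z.k (g b) + ψ.mid v := by
  have hf : E.f u = E.f v := by
    have := congrArg E'.f hx
    simpa only [map_add, f_k, zero_add, f.f_mid] using this
  obtain ⟨w, hw⟩ := hE (E.f v).toMul
  obtain ⟨c, rfl, -⟩ := hw.2 u hf
  obtain ⟨d, rfl, -⟩ := hw.2 v rfl
  simp only [map_add, f.mid_k, ψ.mid_k, ← add_assoc] at hx ⊢
  simp only [← map_add] at hx
  rw [← map_add, ← map_add, ← h, ← h, ← map_add, ← map_add, (f.isRep_mid _ w hw).unique hx]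

/-- Every morphism of Schreier extensions is cocartesian for the direction. -/
theorem existsUnique_desc {E E' Z : Ext M} (hE : E.IsSchreier) (hE' : E'.IsSchreier)
    (hZ : Z.IsSchreier) (f : E ⟶ E') (ψ : E ⟶ Z) (g : E'.K →+ Z.K)
    (hg : ∀ m a, g (act hE' m a) = act hZ m (g a)) (h : ∀ a, g (f.left a) = ψ.left a) :
    ∃! χ : E' ⟶ Z, (∀ a, χ.left a = g a) ∧ f ≫ χ = ψ := by
  -- A noncanonical decomposition `x = k (c x) + f (u x)`; `key` shows that the value assigned to
  -- `x` does not depend on it.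
  choose c u m hu hc using exists_eq_add hE f
  have key : ∀ {x : E'.X} {a : E'.K} {v : E.X}, x = E'.k a + f.mid v →
      Z.k (g (c x)) + ψ.mid (u x) = Z.k (g a) + ψ.mid v := fun {x a v} hx =>
    add_mid_eq hE f ψ g h ((hc x).symm.trans hx)
  refine ⟨{
    left := g
    mid :=
      { toFun := fun x => Z.k (g (c x)) + ψ.mid (u x)
        map_zero' := by
          rw [key (a := 0) (v := 0) (by simp)]
          simp
        map_add' := fun x y => by
          -- The element `u x + u y` need not be a representative, which is why `key` allows an
          -- arbitrary `v`.
          have hxy : x + y = E'.k (c x + act hE' (m x) (c y)) + f.mid (u x + u y) := by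
            conv_lhs => rw [hc x, hc y]
            rw [map_add, map_add, add_assoc, add_assoc, ← add_assoc (f.mid (u x)),
              act_spec hE' (f.isRep_mid _ _ (hu x)), add_assoc]
          rw [key hxy, map_add, map_add, map_add, hg, add_assoc, add_assoc,
            ← add_assoc (ψ.mid (u x)), act_spec hZ (ψ.isRep_mid _ _ (hu x)), add_assoc] }
    mid_k := fun a => by
      change Z.k (g (c (E'.k a))) + ψ.mid (u (E'.k a)) = _
      rw [key (a := a) (v := 0) (by simp)]
      simp
    f_mid := fun x => by
      change Z.f (Z.k (g (c x)) + ψ.mid (u x)) = _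
      conv_rhs => rw [hc x]
      simp only [map_add, f_k, zero_add, f.f_mid, ψ.f_mid]
    isRep_mid := fun n x hx => by
      change Z.IsRep n (Z.k (g (c x)) + ψ.mid (u x))
      have hn : m x = n := by
        have h₁ : E'.f x = E.f (u x) := by
          conv_lhs => rw [hc x]
          simp only [map_add, f_k, zero_add, f.f_mid]
        exact Additive.ofMul.injective ((hu x).1.symm.trans (h₁.symm.trans hx.1))
      have hu' := hu x
      rw [hn] at hu'
      -- Both `x` and `f (u x)` represent `n`, so they differ by the invertible element `c x`, and
      -- `g` preserves invertibility.
      obtain ⟨b, hb, -⟩ := hx.2 (f.mid (u x)) (f.isRep_mid _ _ hu').1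
      have hb0 : b + c x = 0 := by
        refine (f.isRep_mid _ _ hu').unique ?_
        rw [map_add, add_assoc, ← hc x, ← hb, map_zero, zero_add]
      exact (ψ.isRep_mid _ _ hu').add_left (b := g b) (by rw [← map_add, hb0, map_zero]) },
    ⟨fun _ => rfl, hom_ext h fun v => ?_⟩, ?_⟩
  · change Z.k (g (c (f.mid v))) + ψ.mid (u (f.mid v)) = _
    rw [key (a := 0) (v := v) (by simp)]
    simp
  · rintro χ ⟨h₁, rfl⟩
    refine hom_ext h₁ fun x => ?_
    change _ = Z.k (g (c x)) + χ.mid (f.mid (u x))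
    conv_lhs => rw [hc x]
    rw [map_add, χ.mid_k, h₁]

end Ext

/-! ### Factor sets and crossed-product extensions -/

/-- A normalised factor set of `M` with coefficients in a semimodule. -/
structure FactorSet (S : Smod M) where
  c : M → M → S.K
  one_left : ∀ m, c 1 m = 0
  one_right : ∀ m, c m 1 = 0
  cocycle : ∀ l m n, c l m + c (l * m) n = S.η l (c m n) + c l (m * n)

namespace FactorSet

variable {S : Smod M}

/-- The underlying set of the extension given by a factor set. -/
@[ext]
structure Total (_ : FactorSet S) where
  fst : S.K
  snd : M

variable (Φ : FactorSet S)

instance : Add Φ.Total where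
  add x y := ⟨x.fst + S.η x.snd y.fst + Φ.c x.snd y.snd, x.snd * y.snd⟩

instance : Zero Φ.Total where
  zero := ⟨0, 1⟩

instance : AddMonoid Φ.Total where
  nsmul := nsmulRec
  zero_add x := Total.ext
    (show 0 + S.η 1 x.fst + Φ.c 1 x.snd = x.fst by rw [map_one, Φ.one_left]; simp)
    (one_mul _)
  add_zero x := Total.ext
    (show x.fst + S.η x.snd 0 + Φ.c x.snd 1 = x.fst by rw [Φ.one_right]; simp)
    (mul_one _)
  add_assoc x y z := Total.ext
    (show x.fst + S.η x.snd y.fst + Φ.c x.snd y.snd + S.η (x.snd * y.snd) z.fst +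
        Φ.c (x.snd * y.snd) z.snd =
      x.fst + S.η x.snd (y.fst + S.η y.snd z.fst + Φ.c y.snd z.snd) +
        Φ.c x.snd (y.snd * z.snd) by
      have h := Φ.cocycle x.snd y.snd z.snd
      rw [map_mul, map_add, map_add]
      change x.fst + S.η x.snd y.fst + Φ.c x.snd y.snd + S.η x.snd (S.η y.snd z.fst) +
        Φ.c (x.snd * y.snd) z.snd = _
      calc _ = x.fst + S.η x.snd y.fst + S.η x.snd (S.η y.snd z.fst) +
            (Φ.c x.snd y.snd + Φ.c (x.snd * y.snd) z.snd) := by abel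
        _ = _ := by rw [h]; abel)
    (mul_assoc _ _ _)

theorem add_fst (x y : Φ.Total) :
    (x + y).fst = x.fst + S.η x.snd y.fst + Φ.c x.snd y.snd := rfl

theorem add_snd (x y : Φ.Total) : (x + y).snd = x.snd * y.snd := rfl

/-- The extension given by a factor set. -/
def ext : Ext M where
  K := S.K
  X := Φ.Total
  k :=
    { toFun := fun a => ⟨a, 1⟩
      map_zero' := rfl
      map_add' := fun a b => Total.ext
        (by simp [add_fst, Φ.one_left]) (by simp [add_snd]) }
  f :=
    { toFun := fun x => Additive.ofMul x.snd
      map_zero' := rfl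
      map_add' := fun _ _ => rfl }
  k_injective := fun _ _ h => congrArg Total.fst h
  ker_f := fun x => ⟨fun h => ⟨x.fst, Total.ext rfl (Additive.ofMul.injective h).symm⟩,
    fun ⟨_, h⟩ => h ▸ rfl⟩
  f_surjective := fun m => ⟨⟨0, m.toMul⟩, rfl⟩

theorem mk_one_add (a b : S.K) (m : M) : (⟨a, 1⟩ : Φ.Total) + ⟨b, m⟩ = ⟨a + b, m⟩ :=
  Total.ext (show a + S.η 1 b + Φ.c 1 m = a + b by rw [map_one, Φ.one_left]; simp) (one_mul m)

theorem isRep (m : M) : Φ.ext.IsRep m (⟨0, m⟩ : Φ.Total) := by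
  refine ⟨rfl, fun x hx => ⟨x.fst, ?_, fun b hb => ?_⟩⟩
  · exact (Total.ext (add_zero _).symm (show x.snd = m from hx)).trans
      (Φ.mk_one_add x.fst 0 m).symm
  · exact ((congrArg Total.fst (hb.trans (Φ.mk_one_add b 0 m))).trans (add_zero b)).symm

theorem isSchreier : Φ.ext.IsSchreier := fun m => ⟨_, Φ.isRep m⟩

/-- The elements `⟨0, m⟩` are representatives, and normalisation removes the factor set from `⟨0, m⟩
+ ⟨a, 1⟩`. -/
theorem act_ext (h : Φ.ext.IsSchreier) (m : M) (a : S.K) :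
    Ext.act (E := Φ.ext) h m a = S.η m a := by
  refine Ext.act_eq h (Φ.isRep m) (Eq.trans ?_ (Φ.mk_one_add (S.η m a) 0 m).symm)
  exact Total.ext (show 0 + S.η m a + Φ.c m 1 = S.η m a + 0 by rw [Φ.one_right]; abel) (mul_one m)

theorem isSmodSExt : IsSmodSExt M Φ.ext := by
  refine ⟨Φ.isSchreier, fun a => ?_, fun m => ?_, fun m a b => ?_, fun m n a => ?_⟩
  · exact (Φ.act_ext _ 1 a).trans (by rw [map_one]; rfl)
  · exact (Φ.act_ext _ m 0).trans (map_zero (S.η m))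
  · exact (Φ.act_ext _ m _).trans ((map_add (S.η m) a b).trans
      (congrArg₂ (· + ·) (Φ.act_ext _ m a) (Φ.act_ext _ m b)).symm)
  · refine (Φ.act_ext _ (m * n) a).trans (Eq.trans ?_ (Φ.act_ext _ m _).symm)
    exact (congrArg (fun e : AddMonoid.End S.K => e a) (map_mul S.η m n)).trans
      (congrArg (S.η m) (Φ.act_ext _ n a)).symm

end FactorSet

/-! ### Pushforward of an extension along a morphism of semimodules -/

namespace Ext

/-- The extension has, along any morphism to a semimodule from its kernel, a pushforward given by a
factor set. -/
theorem exists_pushforward {E : Ext M} (hE : IsSmodSExt M E) (S : Smod M) (g : E.K →+ S.K)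
    (hg : ∀ m a, g (act hE.choose m a) = S.η m (g a)) :
    ∃ (Φ : FactorSet S) (f : E ⟶ Φ.ext), ∀ a, f.left a = g a := by
  have hS := hE.choose
  have hs : ∃ s : M → E.X, (∀ m, E.IsRep m (s m)) ∧ s 1 = 0 := by
    choose s hs using hS
    classical
    -- Choosing `0` as the representative of `1` normalises the factor set and makes `k a` have
    -- coefficient `a`.
    refine ⟨Function.update s 1 0, fun m => ?_, Function.update_self _ _ _⟩
    rcases eq_or_ne m 1 with rfl | hm
    · rw [Function.update_self]; exact isRep_zero E
    · rw [Function.update_of_ne hm]; exact hs m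
  obtain ⟨s, hs, hs1⟩ := hs
  have hfs : ∀ m n, E.f (s m + s n) = Additive.ofMul (m * n) := fun m n => by
    rw [map_add, (hs m).1, (hs n).1]; rfl
  choose c hc using fun m n => ((hs (m * n)).2 _ (hfs m n)).exists
  let Φ : FactorSet S :=
    { c := fun m n => g (c m n)
      one_left := fun m => by
        rw [← map_zero g]
        congr 1
        refine (hs m).unique ?_
        have := hc 1 m
        rw [hs1, one_mul, zero_add] at this
        rw [← this, map_zero, zero_add]
      one_right := fun m => by
        rw [← map_zero g]
        congr 1
        refine (hs m).unique ?_
        have := hc m 1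
        rw [hs1, mul_one, add_zero] at this
        rw [← this, map_zero, zero_add]
      -- The identity already holds in `E.K`: both sides are the coefficient of `s l + s m + s n`
      -- with respect to one representative, so no cancellation in the kernel is needed.
      cocycle := fun l m n => by
        rw [← hg, ← map_add, ← map_add]
        congr 1
        refine (hs (l * m * n)).unique ?_
        rw [map_add, map_add, add_assoc, ← hc, ← add_assoc, ← hc, add_assoc, mul_assoc, add_assoc,
          ← hc, ← add_assoc (E.k _), ← act_spec hE.choose (hs l), add_assoc, ← hc] }
  choose t ht using fun x => ((hs (E.f x).toMul).2 x rfl).exists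
  have ht' : ∀ {x : E.X} {a : E.K} {m : M}, x = E.k a + s m → t x = a ∧ (E.f x).toMul = m := by
    intro x a m hx
    have hm : (E.f x).toMul = m := by
      rw [hx, map_add, f_k, zero_add, (hs m).1]; rfl
    refine ⟨(hs m).unique ?_, hm⟩
    rw [← hx, ← hm]
    exact (ht x).symm
  let p : E.X → Φ.Total := fun x => ⟨g (t x), (E.f x).toMul⟩
  have hp : ∀ {x : E.X} {a : E.K} {m : M}, x = E.k a + s m → p x = ⟨g a, m⟩ := fun hx => by
    simp only [p, ht' hx]
  refine ⟨Φ,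
    { left := g
      mid :=
        { toFun := p
          map_zero' := (hp (a := 0) (m := 1) (by rw [hs1]; simp)).trans
            (FactorSet.Total.ext (map_zero g) rfl)
          map_add' := fun x y => by
            have hxy : x + y = E.k (t x + act hE.choose (E.f x).toMul (t y) +
                c (E.f x).toMul (E.f y).toMul) + s ((E.f x).toMul * (E.f y).toMul) := by
              conv_lhs => rw [ht x, ht y]
              rw [map_add, map_add, add_assoc, add_assoc, add_assoc, ← hc,
                ← add_assoc (s _), act_spec hE.choose (hs _), add_assoc]
            rw [hp hxy, map_add, map_add, hg]
            rfl }
      mid_k := fun a => hp (m := 1) (by rw [hs1, add_zero])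
      f_mid := fun _ => rfl
      isRep_mid := fun m u hu => ?_ }, fun _ => rfl⟩
  change Φ.ext.IsRep m (p u)
  -- Two representatives of `m` differ by an invertible element `a`, so the image of `u` is the
  -- representative `⟨0, m⟩` translated by the invertible element `g a`.
  obtain ⟨a, ha, -⟩ := (hs m).2 u hu.1
  obtain ⟨b, hb, -⟩ := hu.2 (s m) (hs m).1
  have hb0 : b + a = 0 := (hs m).unique (by
    rw [map_add, add_assoc, ← ha, ← hb, map_zero, zero_add])
  rw [hp ha]
  have := (Φ.isRep m).add_left (a := g a) (b := g b)
    (show g b + g a = 0 by rw [← map_add, hb0, map_zero])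
  have h0 := Φ.mk_one_add (g a) 0 m
  rw [add_zero] at h0
  exact h0 ▸ this

end Ext

/-! ### The direction functors are cofibred in groupoids -/

/-- Over `F.map f` itself, lifting conditions are plain equations between images under `F`, with no
transport along equalities of objects. -/
theorem isStronglyCocartesian_map {U : Type u₁} [Category.{v₁} U] {V : Type u₂} [Category.{v₂} V]
    (F : U ⥤ V) {X Y : U} (f : X ⟶ Y)
    (h : ∀ (Z : U) (g : F.obj Y ⟶ F.obj Z) (ψ : X ⟶ Z), F.map ψ = F.map f ≫ g →
      ∃! χ : Y ⟶ Z, F.map χ = g ∧ f ≫ χ = ψ) :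
    F.IsStronglyCocartesian (F.map f) f where
  universal_property' {Z} g ψ _ := by
    obtain ⟨χ, ⟨rfl, hχ⟩, hun⟩ := h Z g ψ (IsHomLift.eq_of_isHomLift F _ ψ).symm
    exact ⟨χ, ⟨inferInstance, hχ⟩,
      fun χ' ⟨h₁, h₂⟩ => hun χ' ⟨(IsHomLift.eq_of_isHomLift F _ χ').symm, h₂⟩⟩

namespace Smod

theorem eqToHom_mk_hom {K : Type u} [AddCommMonoid K] {η η' : M →* AddMonoid.End K} (h : η = η')
    (h' : (⟨K, η⟩ : Smod M) = ⟨K, η'⟩) (a : K) : Hom.hom (eqToHom h') a = a := by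
  subst h
  rfl

end Smod

/-- The kernel of `Φ.ext` is `S.K` itself, so only the two actions must be identified. Strict
equality is required because fibres are defined by equality of objects. -/
theorem direction_ext {S : Smod M} (Φ : FactorSet S) (h : IsSmodSExt M Φ.ext) :
    ∃ h' : direction ⟨Φ.ext, h⟩ = S, ∀ a : S.K, Smod.Hom.hom (eqToHom h') a = a := by
  have hη : (direction ⟨Φ.ext, h⟩).η = S.η := MonoidHom.ext fun m => AddMonoidHom.ext fun a =>
    Φ.act_ext h.choose m a
  have h' : direction ⟨Φ.ext, h⟩ = S := congrArg (fun η => (⟨S.K, η⟩ : Smod M)) hη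
  exact ⟨h', fun a => Smod.eqToHom_mk_hom hη h' a⟩

instance : CofibredInGroupoids (D M) where
  cocartesian {E E'} f := isStronglyCocartesian_map _ f fun Z g ψ h => by
    obtain ⟨χ, ⟨h₁, h₂⟩, hun⟩ := Ext.existsUnique_desc E.property.choose E'.property.choose
      Z.property.choose f.hom ψ.hom g.hom g.hom_η
      (fun a => (congrArg (fun α => Smod.Hom.hom α a) h).symm)
    exact ⟨ObjectProperty.homMk χ, ⟨Smod.hom_ext h₁, ObjectProperty.hom_ext _ h₂⟩,
      fun χ' h' => ObjectProperty.hom_ext _ (hun χ'.hom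
        ⟨fun a => congrArg (fun α => Smod.Hom.hom α a) h'.1, congrArg (fun α => α.hom) h'.2⟩)⟩
  exists_lift {E N} φ := by
    obtain ⟨Φ, f, hf⟩ := Ext.exists_pushforward E.property N φ.hom φ.hom_η
    obtain ⟨h, h'⟩ := direction_ext Φ Φ.isSmodSExt
    exact ⟨⟨Φ.ext, Φ.isSmodSExt⟩, h, ObjectProperty.homMk f,
      Smod.hom_ext fun a => (h' _).trans (hf a)⟩

instance : CofibredInGroupoids (d M) where
  cocartesian {E E'} f := isStronglyCocartesian_map _ f fun Z g ψ h => by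
    obtain ⟨χ, ⟨h₁, h₂⟩, hun⟩ := Ext.existsUnique_desc E.property.1 E'.property.1
      Z.property.1 f.hom ψ.hom g.hom.hom g.hom.hom_η
      (fun a => (congrArg (fun α => Smod.Hom.hom α.hom a) h).symm)
    exact ⟨ObjectProperty.homMk χ,
      ⟨ObjectProperty.hom_ext _ (Smod.hom_ext h₁), ObjectProperty.hom_ext _ h₂⟩,
      fun χ' h' => ObjectProperty.hom_ext _ (hun χ'.hom
        ⟨fun a => congrArg (fun α => Smod.Hom.hom α.hom a) h'.1,
          congrArg (fun α => α.hom) h'.2⟩)⟩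
  exists_lift {E N} φ := by
    obtain ⟨Φ, f, hf⟩ := Ext.exists_pushforward (IsCCSExt.isSmodSExt _ E.property) N.obj
      φ.hom.hom φ.hom.hom_η
    obtain ⟨h, h'⟩ := direction_ext Φ Φ.isSmodSExt
    -- The pushforward stays among cancellative extensions because its kernel is that of `N`.
    refine ⟨⟨Φ.ext, Φ.isSchreier, N.property⟩, ObjectProperty.FullSubcategory.ext h,
      ObjectProperty.homMk f, ObjectProperty.hom_ext _ (Smod.hom_ext fun a => ?_)⟩
    rw [ObjectProperty.FullSubcategory.comp_hom, ObjectProperty.eqToHom_hom]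
    exact (h' _).trans (hf a)

theorem isComm_smod (N : Smod M) : CofibredInGroupoids.IsComm N := fun _ a b =>
  Smod.hom_ext fun z => add_comm (a.hom z) (b.hom z)

theorem isComm_cSmod (N : CSmod M) : CofibredInGroupoids.IsComm N := fun _ a b =>
  ObjectProperty.hom_ext _ (Smod.hom_ext fun z => add_comm (a.hom.hom z) (b.hom.hom z))

end Schreier

end

theorem mainTheorem2 (M : Type u) [Monoid M] :
    (∀ N : Schreier.Smod M,
      Nonempty (Schreier.FibreTensor (Schreier.D M) N) ∧
      ∀ T T' : Schreier.FibreTensor (Schreier.D M) N,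
        Nonempty (Unique (Schreier.FibreTensor.Comparison T T'))) ∧
    (∀ N : Schreier.CSmod M,
      Nonempty (Schreier.FibreTensor (Schreier.d M) N) ∧
      ∀ T T' : Schreier.FibreTensor (Schreier.d M) N,
        Nonempty (Unique (Schreier.FibreTensor.Comparison T T'))) :=
  ⟨fun N => ⟨⟨Schreier.CofibredInGroupoids.fibreTensor _ (Schreier.isComm_smod N)⟩,
      Schreier.FibreTensor.nonempty_unique_comparison⟩,
    fun N => ⟨⟨Schreier.CofibredInGroupoids.fibreTensor _ (Schreier.isComm_cSmod N)⟩,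
      Schreier.FibreTensor.nonempty_unique_comparison⟩⟩
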